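/- **Theorem (Barnes factorization).** Let $0\le M\le N$ be integers, $a=(a_1,\dots,a_M)$ and $b=(b_0,b_1,\dots,b_N)$ with all $a_i>0$ and $b_j>0$. *Notation.* For $\Re(w)>0$ let $\zeta_M(s,w\,|\,a)$ be the analytic continuation in $s$, to $\mathbb{C}\setminus\{1,\dots,M\}$, of $$\frac{1}{\Gamma(s)}\int_0^\infty t^{s-1}e^{-wt}\prod_{j=1}^M(1-e^{-a_jt})^{-1}\,dt,\qquad \Re(s)>M,$$ and let $L_M(w\,|\,a)$ be the holomorphic continuation to $w\in\mathbb{C}\setminus(-\infty,0]$ of $\partial_s\zeta_M(s,w\,|\,a)|_{s=0}$, $\Re(w)>0$. For a function $h$ put $$(\mathcal{S}_Nh)(q\,|\,b)=\sum_{p=0}^N(-1)^p\sum_{1\le j_1<\cdots<j_p\le N}h(q+b_0+b_{j_1}+\cdots+b_{j_p}),$$ and for $q\in\mathbb{C}\setminus(-\infty,-b_0]$ let $$\eta_{M,N}(q\,|\,a,b)=\exp\bigl((\mathcal{S}_NL_M)(q\,|\,b)-(\mathcal{S}_NL_M)(0\,|\,b)\bigr).$$ Let $\beta_{M,N}(a,b)$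 denote the probability distribution on $(0,1]$ with $\mathbf{E}[\beta_{M,N}(a,b)^q]=\eta_{M,N}(q\,|\,a,b)$ for $\Re(q)>-b_0$. When $M=0$ the argument $a$ is empty; write $\beta_{0,N}(b_0+x)$ for $\beta_{0,N}$ with parameters $(b_0+x,b_1,\dots,b_N)$. For $n=(n_1,\dots,n_M)\in\{0,1,2,\dots\}^M$ put $\Omega=\Omega(n)=\sum_{i=1}^Mn_ia_i$. *Claim.* (1) For every $q\in\mathbb{C}\setminus(-\infty,-b_0]$, $$\eta_{M,N}(q\,|\,a,b)=\prod_{n_1,\dots,n_M=0}^\infty\ \prod_{p=0}^N\ \prod_{1\le j_1<\cdots<j_p\le N}\left(\frac{q+b_0+b_{j_1}+\cdots+b_{j_p}+\Omega}{b_0+b_{j_1}+\cdots+b_{j_p}+\Omega}\right)^{(-1)^{p-1}},$$ where the outer product converges unconditionally (that is, the products over finite subsets of $\{0,1,2,\dots\}^M$ converge along the net of such subsets). The inner product begins with $\frac{b_0+\Omega}{q+b_0+\Omega}$ ($p=0$) and ends with $\Bigl(\frac{q+b_0+\sum_{j=1}^Nb_j+\Omega}{b_0+\sum_{j=1}^Nb_j+\Omega}\Bigr)^{(-1)^{N-1}}$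 ($p=N$). (2) The distribution $\beta_{M,N}(a,b)$ exists, and $$\beta_{M,N}(a,b)\overset{\text{in law}}{=}\prod_{n_1,\dots,n_M=0}^\infty\beta_{0,N}(b_0+\Omega),$$ the factors on the right being independent: if $(X_n)_{n\in\{0,1,2,\dots\}^M}$ are independent random variables on a probability space with $X_n$ distributed as $\beta_{0,N}(b_0+\Omega(n))$, then $\prod_nX_n$ converges almost surely and has the law $\beta_{M,N}(a,b)$. -/

import Mathlib

open MeasureTheory ProbabilityTheory Set

noncomputable section

namespace BarnesBeta

/-- The holomorphic extension to `U` of a function `g` given on `V`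
(the zero function if there is none). Determined on `U` when `U` is open and
connected and `V` is a nonempty open subset of it, see `holomorphicExtension_eqOn`. -/
def holomorphicExtension (g : ℂ → ℂ) (V U : Set ℂ) : ℂ → ℂ :=
  open Classical in
  if h : ∃ G : ℂ → ℂ, DifferentiableOn ℂ G U ∧ EqOn G g V then h.choose else 0

theorem holomorphicExtension_eqOn {g G : ℂ → ℂ} {V U : Set ℂ} (hU : IsOpen U)
    (hU' : IsPreconnected U) (hV : IsOpen V) (hVne : V.Nonempty) (hVU : V ⊆ U)
    (hG : DifferentiableOn ℂ G U) (hGg : EqOn G g V) :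
    EqOn (holomorphicExtension g V U) G U := by
  have h : ∃ G : ℂ → ℂ, DifferentiableOn ℂ G U ∧ EqOn G g V := ⟨G, hG, hGg⟩
  have e : holomorphicExtension g V U = h.choose := by
    simp only [holomorphicExtension, dif_pos h]
  obtain ⟨h1, h2⟩ := h.choose_spec
  rw [e]
  obtain ⟨z, hz⟩ := hVne
  refine (h1.analyticOnNhd hU).eqOn_of_preconnected_of_eventuallyEq (hG.analyticOnNhd hU) hU'
    (hVU hz) ?_
  filter_upwards [hV.mem_nhds hz] with x hx
  rw [h2 hx, hGg hx]

/-- `f(t) = t ^ M * ∏ j, (1 - exp (-a_j t))⁻¹`, used for `t > 0`. -/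
def barnesKernel {M : ℕ} (a : Fin M → ℝ) (t : ℝ) : ℝ :=
  t ^ M * ∏ j, (1 - Real.exp (-(a j * t)))⁻¹

/-- The integral `Γ(s)⁻¹ ∫₀^∞ t ^ (s - 1) e ^ (-w t) f(t) / t ^ M dt`, which defines the Barnes
multiple zeta function for `Re s > M` and `Re w > 0`. -/
def barnesZetaIntegral {M : ℕ} (a : Fin M → ℝ) (w s : ℂ) : ℂ :=
  (Complex.Gamma s)⁻¹ * ∫ t in Ioi (0 : ℝ),
    (t : ℂ) ^ (s - 1) * Complex.exp (-(w * t)) * ((barnesKernel a t / t ^ M : ℝ) : ℂ)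

/-- The Barnes multiple zeta function `ζ_M(s, w | a)` for `Re w > 0`: the continuation of the
integral in the variable `s` from `Re s > M` to the complex plane without the (possible) poles
`1, …, M`. -/
def barnesZeta {M : ℕ} (a : Fin M → ℝ) (w : ℂ) : ℂ → ℂ :=
  holomorphicExtension (barnesZetaIntegral a w) {s | (M : ℝ) < s.re}
    {s | ∀ k ∈ Finset.Icc 1 M, s ≠ (k : ℂ)}

/-- The Barnes multiple log-gamma function `L_M(w | a)`: the continuation of
`∂_s ζ_M(s, w | a)` at `s = 0` in the variable `w`, from `Re w > 0` to the complex plane without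
`(-∞, 0]`. -/
def barnesLogGamma {M : ℕ} (a : Fin M → ℝ) : ℂ → ℂ :=
  holomorphicExtension (fun w => deriv (barnesZeta a w) 0) {w | 0 < w.re} Complex.slitPlane

/-- `b_0 + b_{j_1} + ⋯ + b_{j_p}` for `s = {j_1 < ⋯ < j_p}`; here `b 0 = b_0` and
`b j.succ` is the entry of index `j + 1`. -/
def shift {N : ℕ} (b : Fin (N + 1) → ℝ) (s : Finset (Fin N)) : ℝ :=
  b 0 + ∑ j ∈ s, b j.succ

/-- The operator `𝒮_N`: the alternating sum over all subsets of `{1, …, N}`. -/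
def opS {N : ℕ} (h : ℂ → ℂ) (b : Fin (N + 1) → ℝ) (q : ℂ) : ℂ :=
  ∑ s : Finset (Fin N), (-1 : ℂ) ^ s.card * h (q + shift b s)

/-- `η_{M,N}(q | a, b) = exp ((𝒮_N L_M)(q | b) - (𝒮_N L_M)(0 | b))`. -/
def eta {M N : ℕ} (a : Fin M → ℝ) (b : Fin (N + 1) → ℝ) (q : ℂ) : ℂ :=
  Complex.exp (opS (barnesLogGamma a) b q - opS (barnesLogGamma a) b 0)

/-- `μ` is a probability distribution on `(0, 1]` whose Mellin transform is
`η_{M,N}(q | a, b)` for `Re q > -b_0`. -/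
structure IsBarnesBetaLaw {M N : ℕ} (a : Fin M → ℝ) (b : Fin (N + 1) → ℝ)
    (μ : Measure ℝ) : Prop where
  isProbabilityMeasure : IsProbabilityMeasure μ
  support : μ (Ioc 0 1)ᶜ = 0
  integrable : ∀ q : ℂ, -b 0 < q.re → Integrable (fun x : ℝ => (x : ℂ) ^ q) μ
  mellin : ∀ q : ℂ, -b 0 < q.re → ∫ x : ℝ, (x : ℂ) ^ q ∂μ = eta a b q

/-- The Barnes beta distribution `β_{M,N}(a, b)` (the zero measure if there is none). -/
def barnesBetaLaw {M N : ℕ} (a : Fin M → ℝ) (b : Fin (N + 1) → ℝ) : Measure ℝ :=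
  open Classical in
  if h : ∃ μ : Measure ℝ, IsBarnesBetaLaw a b μ then h.choose else 0

/-- `Ω = ∑ i, n_i a_i`. -/
def latticeSum {M : ℕ} (a : Fin M → ℝ) (n : Fin M → ℕ) : ℝ :=
  ∑ i, (n i : ℝ) * a i

/-- The bracket of the Barnes factorization: the product over all subsets
`s = {j_1 < ⋯ < j_p}` of `{1, …, N}` of the ratio
`(q + b_0 + b_{j_1} + ⋯ + b_{j_p} + Ω) / (b_0 + b_{j_1} + ⋯ + b_{j_p} + Ω)`
raised to the power `(-1) ^ (p - 1)`, written as `(-1) ^ (p + 1)`. -/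
def barnesFactor {N : ℕ} (b : Fin (N + 1) → ℝ) (q : ℂ) (Ω : ℝ) : ℂ :=
  ∏ s : Finset (Fin N),
    ((q + shift b s + Ω) / ((shift b s : ℂ) + Ω)) ^ ((-1 : ℤ) ^ (s.card + 1))

end BarnesBeta

end

noncomputable section

namespace BarnesBeta

open Filter Asymptotics Topology

/-! Expanding `∏ (1 - e^{-a_j t})⁻¹` into the sum of `e^{-Ω(n) t}` suggests that `L_M(w)` is the sum
over `n` of `-log (w + Ω(n))`. This diverges, but the correction needed is only a polynomial in `w`
of degree at most `M`. So `e^{-wt}` is replaced by its Taylor remainder `expRem` of order `M + 1` at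
`w = 1`. The removed terms contribute a polynomial in `w` of degree at most `M` to `∂_s ζ_M(0, w)`.
The remainder has a Mellin integral that converges at `s = 0` and can be integrated term by term
(`mellin_expRem_zero`), giving logarithms minus their Taylor polynomials (`regTerm`). Hence `L_M` is
a polynomial plus a convergent series on the slit plane (`exists_barnesLogGamma_eq`).

`𝒮_N` is an `N`-fold finite difference, so `(𝒮_N P)(q) = (𝒮_N P)(0)` for every polynomial `P` of
degree at most `N` (`opS_polynomial`); this is where `M ≤ N` enters. Both the global polynomial and
the Taylor polynomial of each summand drop out, and exponentiating leaves the product of claim (1)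
(`hasProd_barnesFactor`).

For claim (2), the factor with shift `Ω` is the Mellin transform of `β_{0,N}(b_0 + Ω)`. That law
exists: minus its logarithm is exponential if `N = 0`, and compound Poisson with Lévy density `t⁻¹
e^{-b_0 t} ∏ (1 - e^{-b_j t})` if `N ≥ 1`, by Frullani's integral. Partial products of independent
factors decrease, and their Mellin transforms converge to `η` by (1). Fatou's lemma at a negative
exponent shows that the limit is almost surely positive, and dominated convergence gives its Mellin
transform (`isBarnesBetaLaw_map_tprod`). The infinite product thus also proves that `β_{M,N}`
exists; uniqueness comes from the characteristic function of the logarithm. -/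

/-! ### Entire continuation of normalized Mellin transforms. -/

/-- Local holomorphic continuations to the half planes `Re u > -K` glue to an entire function. -/
theorem exists_entire_of_halfPlanes {g : ℂ → ℂ}
    (h : ∀ K : ℕ, ∃ H : ℂ → ℂ, DifferentiableOn ℂ H {u | -(K : ℝ) < u.re} ∧
      EqOn H g {u | 0 < u.re}) :
    ∃ E : ℂ → ℂ, Differentiable ℂ E ∧ EqOn E g {u | 0 < u.re} := by
  choose H hd he using h
  have hopen (c : ℝ) : IsOpen {u : ℂ | c < u.re} := isOpen_lt continuous_const Complex.continuous_re
  have hpre (c : ℝ) : IsPreconnected {u : ℂ | c < u.re} := (convex_halfSpace_re_gt c).isPreconnected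
  have key : ∀ K L : ℕ, K ≤ L → EqOn (H L) (H K) {u | -(K : ℝ) < u.re} := by
    intro K L hKL
    have hKL' : (K : ℝ) ≤ L := by exact_mod_cast hKL
    have hK0 : (0 : ℝ) ≤ K := by positivity
    refine ((hd L).mono ?_ |>.analyticOnNhd (hopen _)).eqOn_of_preconnected_of_eventuallyEq
      ((hd K).analyticOnNhd (hopen _)) (hpre _) (z₀ := 1) ?_ ?_
    · intro u hu
      simp only [mem_ofPred_eq] at hu ⊢
      linarith
    · simp only [mem_ofPred_eq, Complex.one_re]; linarith
    · filter_upwards [(hopen 0).mem_nhds (by simp : (1 : ℂ) ∈ {u : ℂ | 0 < u.re})] with u hu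
      rw [he L hu, he K hu]
  -- The index `K = ⌈1 - Re u⌉₊` gives `-K ≤ Re u - 1`, so `u` lies in the open half plane of `H K`.
  -- The index jumps as `u` moves, but `key` makes the values agree.
  refine ⟨fun u => H ⌈-u.re + 1⌉₊ u, fun u => ?_, fun u hu => he _ hu⟩
  have hu : u ∈ {v : ℂ | -((⌈-u.re + 1⌉₊ : ℕ) : ℝ) < v.re} := by
    have := Nat.le_ceil (-u.re + 1)
    simp only [mem_ofPred_eq]; linarith
  have hu2 : ∀ᶠ v : ℂ in 𝓝 u, -((⌈-u.re + 1⌉₊ : ℕ) : ℝ) < v.re := (hopen _).mem_nhds hu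
  refine ((hd _).differentiableAt ((hopen _).mem_nhds hu)).congr_of_eventuallyEq ?_
  filter_upwards [hu2] with v hv
  rcases le_total ⌈-u.re + 1⌉₊ ⌈-v.re + 1⌉₊ with hl | hl
  · exact key _ _ hl hv
  · refine (key _ _ hl ?_).symm
    have := Nat.le_ceil (-v.re + 1)
    simp only [mem_ofPred_eq]; linarith

/-- The Mellin transform of a function which is analytic at `0` and decays exponentially,
normalized by the Gamma function, extends to an entire function. -/
theorem exists_entire_mellin {G G₀ : ℝ → ℂ} {δ : ℝ} (hδ : 0 < δ) (hc : ContinuousOn G (Ioi 0))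
    (htop : G =O[atTop] fun t => Real.exp (-δ * t)) (h0 : AnalyticAt ℝ G₀ 0)
    (heq : EqOn G G₀ (Ioi 0)) :
    ∃ E : ℂ → ℂ, Differentiable ℂ E ∧
      EqOn E (fun u => (Complex.Gamma u)⁻¹ * mellin G u) {u | 0 < u.re} := by
  apply exists_entire_of_halfPlanes
  intro K
  obtain ⟨p, hp⟩ := h0
  -- Removing the first `K` Taylor terms, cut off to `(0, 1]`, does not affect the decay at infinity
  -- and makes the rest `O(t ^ K)` at `0`, so its Mellin transform is holomorphic for `Re u > -K`.
  let P : ℕ → ℝ → ℂ := fun k => indicator (Ioc 0 1) fun t => (t : ℂ) ^ (k : ℂ)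
  let Q : ℝ → ℂ := fun t => G t - ∑ k ∈ Finset.range K, p.coeff k * P k t
  have hPloc (k : ℕ) : LocallyIntegrableOn (P k) (Ioi 0) := by
    have h : LocallyIntegrable (fun t : ℝ => (t : ℂ) ^ (k : ℂ)) volume := by
      simp only [Complex.cpow_natCast]
      exact Continuous.locallyIntegrable (by fun_prop)
    have : LocallyIntegrable (P k) volume := h.indicator measurableSet_Ioc
    exact this.locallyIntegrableOn _
  have hQloc : LocallyIntegrableOn Q (Ioi 0) := by
    refine (hc.locallyIntegrableOn measurableSet_Ioi).sub ?_
    have : ∀ n : ℕ, LocallyIntegrableOn (fun t => ∑ k ∈ Finset.range n, p.coeff k * P k t)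
        (Ioi 0) := by
      intro n
      induction n with
      | zero => simpa using locallyIntegrableOn_zero
      | succ n ih =>
        simp only [Finset.sum_range_succ]
        exact ih.add ((hPloc n).smul (p.coeff n))
    exact this K
  have hQtop : Q =O[atTop] fun t => Real.exp (-δ * t) := by
    refine htop.congr' ?_ EventuallyEq.rfl
    filter_upwards [eventually_gt_atTop 1] with t ht
    have : ∀ k, P k t = 0 := fun k => indicator_of_notMem (by simp [ht]) _
    simp [Q, this]
  have hQbot : Q =O[𝓝[>] 0] fun t => t ^ (-(-(K : ℝ))) := by
    have h1 := (hp.isBigO_sub_partialSum_pow K).mono (nhdsWithin_le_nhds (s := Ioi 0))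
    refine h1.congr' ?_ ?_
    · filter_upwards [Ioc_mem_nhdsGT (zero_lt_one' ℝ)] with t ht
      have : ∀ k, P k t = (t : ℂ) ^ k := fun k => by
        simp only [P, indicator_of_mem ht, Complex.cpow_natCast]
      simp only [Q, this, zero_add, heq ht.1, FormalMultilinearSeries.partialSum,
        FormalMultilinearSeries.apply_eq_pow_smul_coeff]
      congr 1
      refine Finset.sum_congr rfl fun k _ => ?_
      rw [mul_comm, Complex.real_smul]; simp
    · filter_upwards [self_mem_nhdsWithin] with t ht
      simp [abs_of_pos (mem_Ioi.1 ht)]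
  -- The truncated monomial `t ^ k` has Mellin transform `1 / (u + k)`. Its pole is cancelled by the
  -- zero of `1 / Γ` at `-k`, and `dslope` is the resulting entire quotient.
  refine ⟨fun u => (Complex.Gamma u)⁻¹ * mellin Q u +
    ∑ k ∈ Finset.range K, p.coeff k * dslope (fun s => (Complex.Gamma s)⁻¹) (-k : ℂ) u, ?_, ?_⟩
  · intro u hu
    refine DifferentiableAt.differentiableWithinAt ?_
    refine (Complex.differentiable_one_div_Gamma.differentiableAt.mul
      (mellin_differentiableAt_of_isBigO_rpow_exp hδ hQloc hQtop hQbot hu)).add ?_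
    refine DifferentiableAt.fun_sum fun k _ => DifferentiableAt.const_mul ?_ _
    have : DifferentiableOn ℂ (dslope (fun s => (Complex.Gamma s)⁻¹) (-k : ℂ)) univ :=
      (Complex.differentiableOn_dslope univ_mem).2
        Complex.differentiable_one_div_Gamma.differentiableOn
    exact this.differentiableAt univ_mem
  · intro u hu
    have hu' : 0 < u.re := hu
    have hPm (k : ℕ) : HasMellin (P k) u (1 / (u + k)) :=
      hasMellin_cpow_Ioc (k : ℂ) (by simp only [Complex.natCast_re]; positivity)
    have hQm : MellinConvergent Q u :=
      mellinConvergent_of_isBigO_rpow_exp hδ hQloc hQtop hQbot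
        (lt_of_le_of_lt (by simp) hu')
    have hS : ∀ n : ℕ, HasMellin (fun t => ∑ k ∈ Finset.range n, p.coeff k * P k t) u
        (∑ k ∈ Finset.range n, p.coeff k * (1 / (u + k))) := by
      intro n
      induction n with
      | zero => simp [HasMellin, MellinConvergent, mellin]
      | succ n ih =>
        simp only [Finset.sum_range_succ]
        have h2 := hasMellin_const_smul (hPm n).1 (p.coeff n)
        have h3 := hasMellin_add ih.1 h2.1
        rw [ih.2, h2.2, (hPm n).2] at h3
        exact h3
    have hG : mellin G u = mellin Q u + ∑ k ∈ Finset.range K, p.coeff k * (1 / (u + k)) := by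
      rw [← (hS K).2, ← (hasMellin_add hQm (hS K).1).2]
      congr 1
      ext t
      simp [Q]
    simp only [hG, mul_add, Finset.mul_sum]
    congr 1
    refine Finset.sum_congr rfl fun k _ => ?_
    have hk : u + k ≠ 0 := fun h => by
      have := congrArg Complex.re h
      simp at this
      have hk : (0 : ℝ) ≤ k := by positivity
      linarith
    rw [dslope_of_ne _ (fun h => hk (by rw [h]; simp)), slope_def_field,
      Complex.Gamma_neg_nat_eq_zero]
    simp only [inv_zero, sub_zero, sub_neg_eq_add]
    field_simp

/-! ### Lattice sums and the geometric kernel. -/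

theorem hasSum_pi_prod_of_nonneg {M : ℕ} {f : Fin M → ℕ → ℝ} {S : Fin M → ℝ}
    (h0 : ∀ i k, 0 ≤ f i k) (h : ∀ i, HasSum (f i) (S i)) :
    HasSum (fun n : Fin M → ℕ => ∏ i, f i (n i)) (∏ i, S i) := by
  induction M with
  | zero => simp
  | succ M ih =>
    have h1 := ih (fun i k => h0 i.succ k) (fun i => h i.succ)
    have h3 : Summable fun x : ℕ × (Fin M → ℕ) => f 0 x.1 * ∏ i, f (Fin.succ i) (x.2 i) :=
      Summable.mul_of_nonneg (f := f 0) (g := fun n : Fin M → ℕ => ∏ i, f (Fin.succ i) (n i))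
        (h 0).summable h1.summable (fun k => h0 0 k)
        (fun n => Finset.prod_nonneg fun i _ => h0 i.succ (n i))
    have h2 := (h 0).mul h1 h3
    rw [← (Fin.consEquiv (fun _ => ℕ)).hasSum_iff, Fin.prod_univ_succ]
    refine h2.congr_fun fun n => ?_
    simp [Fin.consEquiv, Fin.prod_univ_succ]

theorem latticeSum_nonneg {M : ℕ} {a : Fin M → ℝ} (ha : ∀ i, 0 < a i) (n : Fin M → ℕ) :
    0 ≤ latticeSum a n :=
  Finset.sum_nonneg fun i _ => mul_nonneg (Nat.cast_nonneg _) (ha i).le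

/-- `∏ j, (1 - exp (-a_j t))⁻¹` -/
def geomKernel {M : ℕ} (a : Fin M → ℝ) (t : ℝ) : ℝ :=
  ∏ j, (1 - Real.exp (-(a j * t)))⁻¹

theorem hasSum_geomKernel {M : ℕ} {a : Fin M → ℝ} (ha : ∀ i, 0 < a i) {t : ℝ} (ht : 0 < t) :
    HasSum (fun n => Real.exp (-(latticeSum a n * t))) (geomKernel a t) := by
  have h (i : Fin M) : HasSum (fun k : ℕ => Real.exp (-(a i * t)) ^ k)
      (1 - Real.exp (-(a i * t)))⁻¹ :=
    hasSum_geometric_of_lt_one (Real.exp_pos _).le (by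
      rw [Real.exp_lt_one_iff]; have := mul_pos (ha i) ht; linarith)
  have h2 := hasSum_pi_prod_of_nonneg (f := fun i k => Real.exp (-(a i * t)) ^ k)
    (fun i k => (pow_pos (Real.exp_pos _) k).le) h
  refine h2.congr_fun fun n => ?_
  simp only [← Real.exp_nat_mul, ← Real.exp_sum, latticeSum]
  congr 1
  rw [Finset.sum_mul, ← Finset.sum_neg_distrib]
  exact Finset.sum_congr rfl fun i _ => by ring

/-- Since `c + Ω ≥ c + n_i a_i` for each `i`, splitting the power `M + 1` evenly into `M` powers `p
= (M + 1) / M > 1` bounds the summand by a product of one-dimensional convergent series. This is why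
Taylor remainders of order `M + 1` suffice. -/
theorem summable_add_latticeSum {M : ℕ} {a : Fin M → ℝ} (ha : ∀ i, 0 < a i) {c : ℝ} (hc : 0 < c) :
    Summable fun n => ((c + latticeSum a n) ^ (M + 1))⁻¹ := by
  rcases Nat.eq_zero_or_pos M with rfl | hM
  · exact Summable.of_finite
  have hM' : (0 : ℝ) < M := by exact_mod_cast hM
  set p : ℝ := ((M : ℝ) + 1) / M with hp
  have hp1 : 1 < p := by rw [hp, lt_div_iff₀ hM']; linarith
  have h1 (i : Fin M) : Summable fun k : ℕ => ((c + k * a i) ^ p)⁻¹ := by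
    have := ((Real.summable_one_div_nat_add_rpow (c / a i) p).2 hp1).mul_left ((a i ^ p)⁻¹)
    refine this.congr fun k => ?_
    have h3 := div_pos hc (ha i)
    rw [abs_of_pos (by positivity), one_div, ← mul_inv,
      ← Real.mul_rpow (ha i).le (by positivity)]
    congr 2
    have := (ha i).ne'
    field_simp
    ring
  refine Summable.of_nonneg_of_le (fun n => ?_) (fun n => ?_)
    (hasSum_pi_prod_of_nonneg (fun i k => ?_) fun i => (h1 i).hasSum).summable
  · have := latticeSum_nonneg ha n
    positivity
  · have h0 := latticeSum_nonneg ha n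
    have : (c + latticeSum a n) ^ (M + 1) = ∏ _i : Fin M, (c + latticeSum a n) ^ p := by
      rw [Finset.prod_const, Finset.card_univ, Fintype.card_fin, ← Real.rpow_natCast,
        ← Real.rpow_natCast, ← Real.rpow_mul (by positivity), hp,
        div_mul_cancel₀ _ hM'.ne']
      push_cast; rfl
    rw [this, ← Finset.prod_inv_distrib]
    refine Finset.prod_le_prod (fun i _ => by positivity) fun i _ => ?_
    have hai := (ha i).le
    refine inv_anti₀ (by positivity) (Real.rpow_le_rpow (by positivity) ?_ (by linarith))
    have : (n i : ℝ) * a i ≤ latticeSum a n :=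
      Finset.single_le_sum (f := fun i => (n i : ℝ) * a i)
        (fun j _ => mul_nonneg (Nat.cast_nonneg _) (ha j).le) (Finset.mem_univ i)
    linarith
  · have hai := (ha i).le
    positivity

theorem continuousOn_geomKernel {M : ℕ} {a : Fin M → ℝ} (ha : ∀ i, 0 < a i) :
    ContinuousOn (geomKernel a) (Ioi 0) := by
  refine continuousOn_finsetProd _ fun i _ => ContinuousOn.inv₀ (by fun_prop) fun t ht => ?_
  have : Real.exp (-(a i * t)) < 1 := by
    rw [Real.exp_lt_one_iff]; have := mul_pos (ha i) (mem_Ioi.1 ht); linarith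
  linarith

theorem geomKernel_isBigO_atTop {M : ℕ} {a : Fin M → ℝ} (ha : ∀ i, 0 < a i) :
    geomKernel a =O[atTop] fun _ => (1 : ℝ) := by
  have : Tendsto (geomKernel a) atTop (𝓝 (∏ _i : Fin M, (1 - 0)⁻¹)) := by
    refine tendsto_finsetProd _ fun i _ => Tendsto.inv₀ (tendsto_const_nhds.sub ?_) (by simp)
    refine Real.tendsto_exp_neg_atTop_nhds_zero.comp ?_
    exact tendsto_id.const_mul_atTop (ha i)
  exact this.isBigO_one ℝ

/-- The analytic version at `0` of `t ^ M * geomKernel a t`. -/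
def smoothKernel {M : ℕ} (a : Fin M → ℝ) (t : ℝ) : ℝ :=
  ∏ j, (dslope (fun x => 1 - Real.exp (-(a j * x))) 0 t)⁻¹

theorem smoothKernel_eq {M : ℕ} (a : Fin M → ℝ) {t : ℝ} (ht : 0 < t) :
    smoothKernel a t = t ^ M * geomKernel a t := by
  have : t ^ M = ∏ _i : Fin M, t := by simp
  rw [smoothKernel, geomKernel, this, ← Finset.prod_mul_distrib]
  refine Finset.prod_congr rfl fun i _ => ?_
  rw [dslope_of_ne _ ht.ne', slope_def_field]
  simp [div_eq_mul_inv]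

theorem analyticAt_smoothKernel {M : ℕ} {a : Fin M → ℝ} (ha : ∀ i, 0 < a i) :
    AnalyticAt ℝ (smoothKernel a) 0 := by
  have h (i : Fin M) : AnalyticAt ℝ
      (fun t => (dslope (fun x => 1 - Real.exp (-(a i * x))) 0 t)⁻¹) 0 := by
    have h1 : AnalyticAt ℝ (fun x => 1 - Real.exp (-(a i * x))) 0 := by fun_prop
    obtain ⟨p, hp⟩ := h1
    refine AnalyticAt.inv ⟨_, hp.has_fpower_series_dslope_fslope⟩ ?_
    rw [dslope_same]
    have : HasDerivAt (fun x => 1 - Real.exp (-(a i * x))) (a i) 0 := by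
      have := ((((hasDerivAt_id (0 : ℝ)).const_mul (a i)).neg).exp).const_sub 1
      simpa using this
    rw [this.deriv]
    exact (ha i).ne'
  exact Finset.analyticAt_fun_prod _ fun i _ => h i

theorem geomKernel_isBigO_zero {M : ℕ} {a : Fin M → ℝ} (ha : ∀ i, 0 < a i) :
    geomKernel a =O[𝓝[>] 0] fun t => t ^ (-(M : ℝ)) := by
  have h1 : smoothKernel a =O[𝓝[>] 0] fun _ => (1 : ℝ) :=
    ((analyticAt_smoothKernel ha).continuousAt.isBigO_one ℝ).mono nhdsWithin_le_nhds
  have h2 := h1.mul (isBigO_refl (fun t : ℝ => t ^ (-(M : ℝ))) (𝓝[>] 0))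
  refine h2.congr' ?_ (by simp)
  filter_upwards [self_mem_nhdsWithin] with t ht
  have ht := mem_Ioi.1 ht
  rw [smoothKernel_eq a ht, Real.rpow_neg ht.le, Real.rpow_natCast]
  field_simp

/-! ### Frullani integrals and the series of regularized logarithms. -/

/-- A complex exponential version of Frullani's integral. -/
theorem integral_frullani_exp {r : ℝ} {u : ℂ} (hr : 0 < r) (hu : 0 < u.re) :
    ∫ t in Ioi (0 : ℝ), (t : ℂ)⁻¹ * (Complex.exp (-(u * t)) - Complex.exp (-(r * t))) =
      -Complex.log (1 + (u - r) / r) := by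
  -- Along the segment from `r` to `u` the real part stays at least `m`, so `e^{-mt}` dominates the
  -- double integral over `t` and `τ`. Fubini then yields the integral form of the logarithm.
  set m := min u.re r
  have hm : 0 < m := lt_min hu hr
  let f : ℝ → ℝ → ℂ := fun t τ => Complex.exp (-((r + τ * (u - r)) * t))
  have hre (τ : ℝ) (h0 : 0 ≤ τ) (h1 : τ ≤ 1) : m ≤ ((r : ℂ) + τ * (u - r)).re := by
    have h2 : m ≤ u.re := min_le_left _ _
    have h3 : m ≤ r := min_le_right _ _
    simp only [Complex.add_re, Complex.ofReal_re, Complex.mul_re, Complex.sub_re,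
      Complex.ofReal_im, zero_mul, sub_zero]
    nlinarith [mul_nonneg h0 (sub_nonneg.2 h2), mul_nonneg (sub_nonneg.2 h1) (sub_nonneg.2 h3)]
  have e1 (t : ℝ) (ht : t ∈ Ioi (0 : ℝ)) :
      (t : ℂ)⁻¹ * (Complex.exp (-(u * t)) - Complex.exp (-(r * t))) =
        -(u - r) * ∫ τ in Ioc (0 : ℝ) 1, f t τ := by
    have ht0 : (t : ℂ) ≠ 0 := by exact_mod_cast (mem_Ioi.1 ht).ne'
    have hd (τ : ℝ) : HasDerivAt (fun τ : ℝ => Complex.exp (-((r + τ * (u - r)) * t)))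
        (f t τ * (-((u - r) * t))) τ := by
      have : HasDerivAt (fun τ : ℝ => -(((r : ℂ) + τ * (u - r)) * t)) (-((u - r) * t)) τ := by
        have := ((((hasDerivAt_id (τ : ℂ)).mul_const (u - r)).const_add (r : ℂ)).mul_const
          (t : ℂ)).neg.comp_ofReal
        simpa using this
      exact this.cexp
    have := intervalIntegral.integral_eq_sub_of_hasDerivAt (fun τ _ => hd τ)
      (Continuous.intervalIntegrable (by fun_prop) 0 1)
    rw [intervalIntegral.integral_mul_const, intervalIntegral.integral_of_le zero_le_one] at this
    simp only [Complex.ofReal_one, one_mul, Complex.ofReal_zero, zero_mul, add_zero,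
      add_sub_cancel] at this
    rw [← this]
    field_simp
  have hint : Integrable (Function.uncurry f)
      ((volume.restrict (Ioi 0)).prod (volume.restrict (Ioc 0 1))) := by
    have hb : Integrable (fun x : ℝ × ℝ => Real.exp (-m * x.1) * 1)
        ((volume.restrict (Ioi 0)).prod (volume.restrict (Ioc 0 1))) :=
      Integrable.mul_prod (f := fun t : ℝ => Real.exp (-m * t)) (g := fun _ : ℝ => (1 : ℝ))
        (exp_neg_integrableOn_Ioi 0 hm) (integrable_const _)
    refine hb.mono' (Continuous.aestronglyMeasurable (by fun_prop)) ?_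
    rw [Measure.prod_restrict]
    filter_upwards [ae_restrict_mem (measurableSet_Ioi.prod measurableSet_Ioc)] with x hx
    simp only [Function.uncurry, f, Complex.norm_exp, mul_one]
    refine Real.exp_le_exp.2 ?_
    have h1 := hre x.2 hx.2.1.le hx.2.2
    have h2 : 0 < x.1 := hx.1
    rw [Complex.neg_re, Complex.re_mul_ofReal]
    nlinarith
  have hslit : (1 : ℂ) + (u - r) / r ∈ Complex.slitPlane := by
    refine Or.inl ?_
    have hr' : (r : ℂ) ≠ 0 := by exact_mod_cast hr.ne'
    have : (1 : ℂ) + (u - r) / r = u / r := by field_simp; ring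
    rw [this, Complex.div_ofReal_re]
    positivity
  rw [setIntegral_congr_fun measurableSet_Ioi e1, integral_const_mul,
    integral_integral_swap hint, Complex.log_eq_integral hslit,
    intervalIntegral.integral_of_le zero_le_one, ← integral_const_mul, ← integral_const_mul,
    ← integral_neg]
  refine setIntegral_congr_fun measurableSet_Ioc fun τ hτ => ?_
  have h1 := hre τ hτ.1.le hτ.2
  have h2 : (r : ℂ) + τ * (u - r) ≠ 0 := fun h => by rw [h] at h1; simp at h1; linarith
  have hr' : (r : ℂ) ≠ 0 := by exact_mod_cast hr.ne'
  have h3 := integral_exp_mul_complex_Ioi (a := -((r : ℂ) + τ * (u - r)))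
    (by rw [Complex.neg_re]; linarith) 0
  simp only [f]
  simp only [neg_mul, Complex.ofReal_zero, mul_zero, Complex.exp_zero] at h3
  rw [h3, Complex.real_smul]
  have h4 : (1 : ℂ) + τ * ((u - r) / r) ≠ 0 := by
    have : (1 : ℂ) + τ * ((u - r) / r) = (r + τ * (u - r)) / r := by field_simp
    rw [this]; exact div_ne_zero h2 hr'
  field_simp

/-- The Taylor remainder of order `M + 1` of `w ↦ exp (-w t)` at `w = 1`. -/
def expRem (M : ℕ) (w : ℂ) (t : ℝ) : ℂ :=
  Complex.exp (-(w * t)) -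
    Complex.exp (-t) * ∑ k ∈ Finset.range (M + 1), (-((w - 1) * t)) ^ k / (k.factorial : ℂ)

theorem continuous_expRem (M : ℕ) (w : ℂ) : Continuous (expRem M w) := by
  unfold expRem; fun_prop

theorem exists_norm_expRem_le (M : ℕ) (w : ℂ) :
    ∃ C : ℝ, 0 ≤ C ∧ ∀ t : ℝ, 0 < t →
      ‖expRem M w t‖ ≤ C * (t ^ (M + 1) * Real.exp (-(min w.re 1 * t))) := by
  set m := min w.re 1
  set D := ‖w - 1‖ with hD
  have hD0 : 0 ≤ D := norm_nonneg _
  set S := ∑ k ∈ Finset.range (M + 1), D ^ k / (k.factorial : ℝ)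
  have hS : 0 ≤ S := Finset.sum_nonneg fun k _ => by positivity
  refine ⟨1 + S + D ^ (M + 1) * Real.exp D, by positivity, fun t ht => ?_⟩
  have hm1 : m ≤ 1 := min_le_right _ _
  have hmw : m ≤ w.re := min_le_left _ _
  have et : Real.exp (-t) ≤ Real.exp (-(m * t)) := Real.exp_le_exp.2 (by nlinarith)
  have en : ‖Complex.exp (-(t : ℂ))‖ = Real.exp (-t) := by simp [Complex.norm_exp]
  have hx (k : ℕ) : ‖(-((w - 1) * t)) ^ k / (k.factorial : ℂ)‖ = D ^ k * t ^ k / k.factorial := by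
    simp [hD, abs_of_pos ht, mul_pow]
  have hE : 0 < t ^ (M + 1) * Real.exp (-(m * t)) := by positivity
  -- For `t ≤ 1` the Taylor estimate for `exp (-(w - 1) t)` supplies the power `t ^ (M + 1)`; for `t
  -- ≥ 1` each term is bounded separately by `t ^ k ≤ t ^ (M + 1)`.
  rcases le_total t 1 with h1 | h1
  · have : expRem M w t = Complex.exp (-t) * (Complex.exp (-((w - 1) * t)) -
        ∑ k ∈ Finset.range (M + 1), (-((w - 1) * t)) ^ k / (k.factorial : ℂ)) := by
      rw [expRem, mul_sub, ← Complex.exp_add]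
      congr 2; ring
    have hn : ‖-((w - 1) * (t : ℂ))‖ = D * t := by simp [hD, abs_of_pos ht]
    have h2 := Complex.norm_exp_sub_sum_le_norm_mul_exp (-((w - 1) * t)) (M + 1)
    rw [hn] at h2
    rw [this, norm_mul, en]
    calc _ ≤ Real.exp (-(m * t)) * ((D * t) ^ (M + 1) * Real.exp (D * t)) :=
          mul_le_mul et h2 (norm_nonneg _) (Real.exp_pos _).le
      _ ≤ Real.exp (-(m * t)) * ((D * t) ^ (M + 1) * Real.exp D) := by
          gcongr; nlinarith
      _ = (D ^ (M + 1) * Real.exp D) * (t ^ (M + 1) * Real.exp (-(m * t))) := by ring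
      _ ≤ _ := by
          refine mul_le_mul_of_nonneg_right ?_ hE.le
          linarith
  · have hT : 1 ≤ t ^ (M + 1) := one_le_pow₀ h1
    have e1 : ‖Complex.exp (-(w * t))‖ ≤ t ^ (M + 1) * Real.exp (-(m * t)) := by
      rw [Complex.norm_exp, Complex.neg_re, Complex.re_mul_ofReal]
      have : Real.exp (-(w.re * t)) ≤ Real.exp (-(m * t)) := Real.exp_le_exp.2 (by nlinarith)
      nlinarith [Real.exp_pos (-(m * t))]
    have e2 : ‖∑ k ∈ Finset.range (M + 1), (-((w - 1) * t)) ^ k / (k.factorial : ℂ)‖ ≤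
        S * t ^ (M + 1) := by
      refine (norm_sum_le _ _).trans ?_
      rw [Finset.sum_mul]
      refine Finset.sum_le_sum fun k hk => ?_
      rw [hx, mul_div_right_comm]
      gcongr
      exact (Finset.mem_range.1 hk).le
    calc ‖expRem M w t‖ ≤ t ^ (M + 1) * Real.exp (-(m * t)) +
          Real.exp (-(m * t)) * (S * t ^ (M + 1)) := by
          refine (norm_sub_le _ _).trans (add_le_add e1 ?_)
          rw [norm_mul, en]
          exact mul_le_mul et e2 (norm_nonneg _) (Real.exp_pos _).le
      _ = (1 + S) * (t ^ (M + 1) * Real.exp (-(m * t))) := by ring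
      _ ≤ _ := by
          refine mul_le_mul_of_nonneg_right ?_ hE.le
          have : 0 ≤ D ^ (M + 1) * Real.exp D := by positivity
          linarith

theorem integral_pow_mul_exp_neg_mul {r : ℝ} (hr : 0 < r) (k : ℕ) :
    ∫ t in Ioi (0 : ℝ), t ^ k * Real.exp (-(r * t)) = k.factorial * (r ^ (k + 1))⁻¹ := by
  have := Real.integral_rpow_mul_exp_neg_mul_Ioi (a := k + 1) (by positivity) hr
  rw [Real.Gamma_nat_eq_factorial, add_sub_cancel_right] at this
  simp only [Real.rpow_natCast] at this
  rw [this, mul_comm, one_div, ← Nat.cast_succ, Real.rpow_natCast, inv_pow]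

theorem integrableOn_pow_mul_exp_neg_mul {r : ℝ} (hr : 0 < r) (k : ℕ) :
    IntegrableOn (fun t : ℝ => t ^ k * Real.exp (-(r * t))) (Ioi 0) :=
  -- The integral of a nonintegrable function is `0` by convention, so a nonzero value proves
  -- integrability.
  Integrable.of_integral_ne_zero (by
    rw [integral_pow_mul_exp_neg_mul hr]; positivity)

/-- The bound for the integrand of `integral_expRem`. -/
theorem norm_inv_mul_expRem_le {M : ℕ} {w : ℂ} {C : ℝ}
    (h : ∀ t : ℝ, 0 < t → ‖expRem M w t‖ ≤ C * (t ^ (M + 1) * Real.exp (-(min w.re 1 * t))))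
    (Ω : ℝ) {t : ℝ} (ht : 0 < t) :
    ‖(t : ℂ)⁻¹ * (expRem M w t * (Real.exp (-(Ω * t)) : ℝ))‖ ≤
      C * (t ^ M * Real.exp (-((min w.re 1 + Ω) * t))) := by
  rw [norm_mul, norm_mul, norm_inv, Complex.norm_real, Complex.norm_real,
    Real.norm_of_nonneg (Real.exp_pos _).le, Real.norm_of_nonneg ht.le]
  calc _ ≤ t⁻¹ * (C * (t ^ (M + 1) * Real.exp (-(min w.re 1 * t))) * Real.exp (-(Ω * t))) := by
        gcongr; exact h t ht
    _ = C * (t ^ M * (Real.exp (-(min w.re 1 * t)) * Real.exp (-(Ω * t)))) := by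
        rw [pow_succ]; field_simp
    _ = _ := by rw [← Real.exp_add]; congr 3; ring

theorem integrableOn_inv_mul_expRem (M : ℕ) {w : ℂ} (hw : 0 < w.re) {Ω : ℝ} (hΩ : 0 ≤ Ω) :
    IntegrableOn (fun t : ℝ => (t : ℂ)⁻¹ * (expRem M w t * (Real.exp (-(Ω * t)) : ℝ)))
      (Ioi 0) := by
  obtain ⟨C, _, h⟩ := exists_norm_expRem_le M w
  have hm : 0 < min w.re 1 := lt_min hw one_pos
  refine Integrable.mono' ((integrableOn_pow_mul_exp_neg_mul (r := min w.re 1 + Ω)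
    (by linarith) M).const_mul C) ?_ ?_
  · refine ContinuousOn.aestronglyMeasurable (fun t ht => ?_) measurableSet_Ioi
    have : (t : ℂ) ≠ 0 := by exact_mod_cast (mem_Ioi.1 ht).ne'
    have h2 := (continuous_expRem M w).continuousAt (x := t)
    exact ContinuousAt.continuousWithinAt (by fun_prop (disch := assumption))
  · filter_upwards [ae_restrict_mem measurableSet_Ioi] with t ht
    exact norm_inv_mul_expRem_le h Ω ht

theorem integral_expRem (M : ℕ) {w : ℂ} (hw : 0 < w.re) {Ω : ℝ} (hΩ : 0 ≤ Ω) :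
    ∫ t in Ioi (0 : ℝ), (t : ℂ)⁻¹ * (expRem M w t * (Real.exp (-(Ω * t)) : ℝ)) =
      -(Complex.log (1 + (w - 1) / (1 + Ω)) - Complex.logTaylor (M + 1) ((w - 1) / (1 + Ω))) := by
  have h1Ω : (1 : ℂ) + Ω ≠ 0 := by
    have : (1 : ℝ) + Ω ≠ 0 := by positivity
    exact_mod_cast this
  induction M with
  | zero =>
    have := integral_frullani_exp (r := 1 + Ω) (u := w + Ω) (by linarith) (by simp; linarith)
    -- `logTaylor 1` vanishes: its only term has denominator `0`, and division by zero gives `0`.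
    rw [Complex.logTaylor_succ, Complex.logTaylor_zero]
    simp only [Pi.add_apply, Nat.cast_zero, div_zero, add_zero, sub_zero]
    push_cast at this
    rw [show w + Ω - (1 + Ω) = w - 1 by ring] at this
    rw [← this]
    refine setIntegral_congr_fun measurableSet_Ioi fun t _ => ?_
    simp only [expRem, zero_add, Finset.range_one, Finset.sum_singleton, pow_zero,
      Nat.factorial_zero, Nat.cast_one, div_one, mul_one]
    push_cast
    rw [sub_mul, ← Complex.exp_add, ← Complex.exp_add]
    congr 3 <;> ring_nf
  | succ M ih =>
    -- Raising the order removes one more monomial times `e^{-t}`, whose Gamma integral is exactly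
    -- the next Taylor term of the logarithm.
    have e (t : ℝ) (ht : t ∈ Ioi (0 : ℝ)) :
        (t : ℂ)⁻¹ * (expRem (M + 1) w t * (Real.exp (-(Ω * t)) : ℝ)) =
        (t : ℂ)⁻¹ * (expRem M w t * (Real.exp (-(Ω * t)) : ℝ)) -
          (-(w - 1)) ^ (M + 1) / ((M + 1).factorial : ℂ) *
            ((t ^ M * Real.exp (-((1 + Ω) * t)) : ℝ) : ℂ) := by
      have ht0 : (t : ℂ) ≠ 0 := by exact_mod_cast (mem_Ioi.1 ht).ne'
      have h1 : Real.exp (-((1 + Ω) * t)) = Real.exp (-t) * Real.exp (-(Ω * t)) := by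
        rw [← Real.exp_add]; congr 1; ring
      have h2 : (-((w - 1) * t)) ^ (M + 1) = (-(w - 1)) ^ (M + 1) * (t ^ M * t) := by
        rw [← pow_succ, ← mul_pow]; congr 1; ring
      rw [expRem, expRem, Finset.sum_range_succ _ (M + 1), h1, h2]
      push_cast
      field_simp
      ring
    rw [setIntegral_congr_fun measurableSet_Ioi e, integral_sub
      (integrableOn_inv_mul_expRem M hw hΩ), ih, integral_const_mul, integral_complex_ofReal,
      integral_pow_mul_exp_neg_mul (by linarith), Complex.logTaylor_succ (M + 1)]
    · have hf : (M.factorial : ℂ) ≠ 0 := by exact_mod_cast M.factorial_ne_zero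
      have hM : (M : ℂ) + 1 ≠ 0 := by exact_mod_cast M.succ_ne_zero
      simp only [Pi.add_apply, Nat.factorial_succ]
      push_cast
      rw [neg_pow (w - 1), div_pow, pow_succ (-1 : ℂ) (M + 1)]
      field_simp
      ring
    · exact ((integrableOn_pow_mul_exp_neg_mul (r := 1 + Ω) (by linarith) M).ofReal).const_mul _

/-- The summand of the Weierstrass-type series for the multiple log-gamma function. -/
def regTerm (M : ℕ) (w : ℂ) (Ω : ℝ) : ℂ :=
  -(Complex.log (1 + (w - 1) / (1 + Ω)) - Complex.logTaylor (M + 1) ((w - 1) / (1 + Ω)))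

theorem one_add_div_mem_slitPlane {w : ℂ} (hw : w ∈ Complex.slitPlane) {Ω : ℝ} (hΩ : 0 ≤ Ω) :
    1 + (w - 1) / (1 + Ω) ∈ Complex.slitPlane := by
  have h1 : (0 : ℝ) < 1 + Ω := by positivity
  have h2 : (1 : ℂ) + (w - 1) / (1 + Ω) = (((1 + Ω)⁻¹ : ℝ) : ℂ) * (w + Ω) := by
    have : (1 : ℂ) + Ω ≠ 0 := by exact_mod_cast h1.ne'
    push_cast
    field_simp
    ring
  rw [h2, Complex.mem_slitPlane_iff, Complex.re_ofReal_mul, Complex.im_ofReal_mul]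
  rcases Complex.mem_slitPlane_iff.1 hw with h | h
  · left
    simp only [Complex.add_re, Complex.ofReal_re]
    positivity
  · right
    simp only [Complex.add_im, Complex.ofReal_im, add_zero]
    exact mul_ne_zero (inv_ne_zero h1.ne') h

theorem differentiableAt_regTerm (M : ℕ) {w : ℂ} (hw : w ∈ Complex.slitPlane) {Ω : ℝ}
    (hΩ : 0 ≤ Ω) : DifferentiableAt ℂ (fun w => regTerm M w Ω) w := by
  have h1 := one_add_div_mem_slitPlane hw hΩ
  unfold regTerm Complex.logTaylor
  fun_prop (disch := assumption)

/-- All but finitely many `Ω` exceed `2R - 1`. Then `z = (w - 1) / (1 + Ω)` has norm at most `1/2`,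
and the remainder of the logarithm is at most `‖z‖ ^ (M + 1) / (1 - ‖z‖) ≤ 2 ‖z‖ ^ (M + 1)`.
Uniformity in `w` is what makes the sum holomorphic. -/
theorem eventually_norm_regTerm_le {M : ℕ} {a : Fin M → ℝ} (ha : ∀ i, 0 < a i) {R : ℝ}
    (hR : 0 < R) : ∀ᶠ n in cofinite, ∀ w : ℂ, ‖w - 1‖ ≤ R →
      ‖regTerm M w (latticeSum a n)‖ ≤
        2 * R ^ (M + 1) * ((1 + latticeSum a n) ^ (M + 1))⁻¹ := by
  have h := (summable_add_latticeSum ha one_pos).tendsto_cofinite_zero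
  have h2 : (0 : ℝ) < ((2 * R) ^ (M + 1))⁻¹ := by positivity
  filter_upwards [h.eventually (gt_mem_nhds h2)] with n hn w hw
  have h0 := latticeSum_nonneg ha n
  set Ω := latticeSum a n
  have h3 : 2 * R < 1 + Ω := by
    rw [inv_lt_inv₀ (by positivity) (by positivity)] at hn
    exact lt_of_pow_lt_pow_left₀ _ (by positivity) hn
  set z : ℂ := (w - 1) / (1 + Ω) with hz
  have hzn : ‖z‖ ≤ R / (1 + Ω) := by
    have : ‖(1 : ℂ) + Ω‖ = 1 + Ω := by
      rw [← Complex.ofReal_one, ← Complex.ofReal_add, Complex.norm_real, Real.norm_of_nonneg]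
      positivity
    rw [hz, norm_div, this]
    gcongr
  have hz2 : ‖z‖ ≤ 1 / 2 := hzn.trans (by rw [div_le_div_iff₀] <;> linarith)
  have h4 := Complex.norm_log_sub_logTaylor_le M (z := z) (by linarith)
  rw [regTerm, norm_neg]
  refine h4.trans ?_
  have h5 : (1 - ‖z‖)⁻¹ ≤ 2 := by
    rw [inv_le_comm₀ (by linarith) two_pos]; linarith
  calc _ ≤ ‖z‖ ^ (M + 1) * (1 - ‖z‖)⁻¹ / 1 := by
        gcongr
        · have : 0 ≤ (1 - ‖z‖)⁻¹ := inv_nonneg.2 (by linarith)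
          positivity
        · have : (0 : ℝ) ≤ M := by positivity
          linarith
    _ ≤ (R / (1 + Ω)) ^ (M + 1) * 2 := by
        rw [div_one]
        gcongr
        exact inv_nonneg.2 (by linarith)
    _ = _ := by rw [div_pow]; ring

theorem summable_regTerm {M : ℕ} {a : Fin M → ℝ} (ha : ∀ i, 0 < a i) (w : ℂ) :
    Summable fun n => regTerm M w (latticeSum a n) := by
  refine Summable.of_norm_bounded_eventually
    (((summable_add_latticeSum ha one_pos).mul_left (2 * (‖w - 1‖ + 1) ^ (M + 1)))) ?_
  filter_upwards [eventually_norm_regTerm_le ha (R := ‖w - 1‖ + 1) (by positivity)] with n hn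
  exact hn w (by linarith)

theorem differentiableOn_tsum_regTerm {M : ℕ} {a : Fin M → ℝ} (ha : ∀ i, 0 < a i) :
    DifferentiableOn ℂ (fun w => ∑' n, regTerm M w (latticeSum a n)) Complex.slitPlane := by
  intro w₀ hw₀
  obtain ⟨r, hr, hsub⟩ := Metric.nhds_basis_closedBall.mem_iff.1
    (Complex.isOpen_slitPlane.mem_nhds hw₀)
  have hbd (n : Fin M → ℕ) : ∃ B : ℝ, ∀ w ∈ Metric.closedBall w₀ r,
      ‖regTerm M w (latticeSum a n)‖ ≤ B :=
    (isCompact_closedBall w₀ r).exists_bound_of_continuousOn fun w hw =>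
      (differentiableAt_regTerm M (hsub hw)
        (latticeSum_nonneg ha n)).continuousAt.continuousWithinAt
  choose B hB using hbd
  set R := ‖w₀ - 1‖ + r
  have hR : 0 < R := by positivity
  set v : (Fin M → ℕ) → ℝ := fun n => 2 * R ^ (M + 1) * ((1 + latticeSum a n) ^ (M + 1))⁻¹
  have hv : Summable v := (summable_add_latticeSum ha one_pos).mul_left _
  have hev := eventually_norm_regTerm_le ha hR
  classical
  let p : (Fin M → ℕ) → Prop := fun n => ∀ w : ℂ, ‖w - 1‖ ≤ R →
    ‖regTerm M w (latticeSum a n)‖ ≤ v n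
  -- The uniform bound may fail for finitely many `n`, where it is replaced by the maximum on the
  -- compact ball.
  have hu : Summable fun n => if p n then v n else B n := by
    refine hv.congr_cofinite ?_
    filter_upwards [hev] with n hn
    exact (if_pos hn).symm
  have hd := Complex.differentiableOn_tsum_of_summable_norm (U := Metric.ball w₀ r)
    (F := fun n w => regTerm M w (latticeSum a n)) hu
    (fun n w hw => (differentiableAt_regTerm M (hsub (Metric.ball_subset_closedBall hw))
      (latticeSum_nonneg ha n)).differentiableWithinAt) Metric.isOpen_ball
    (fun n w hw => by
      split_ifs with h
      · refine h w ?_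
        have h1 : ‖w - w₀‖ < r := mem_ball_iff_norm.1 hw
        calc ‖w - 1‖ = ‖(w₀ - 1) + (w - w₀)‖ := by congr 1; ring
          _ ≤ R := (norm_add_le _ _).trans (by linarith)
      · exact hB n w (Metric.ball_subset_closedBall hw))
  exact (hd.differentiableAt (Metric.ball_mem_nhds w₀ hr)).differentiableWithinAt

/-- Term by term integration of `t⁻¹ * expRem * geomKernel`. -/
theorem mellin_expRem_zero {M : ℕ} {a : Fin M → ℝ} (ha : ∀ i, 0 < a i) {w : ℂ} (hw : 0 < w.re) :
    mellin (fun t => expRem M w t * (geomKernel a t : ℂ)) 0 =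
      ∑' n, regTerm M w (latticeSum a n) := by
  obtain ⟨C, hC, h⟩ := exists_norm_expRem_le M w
  have hm : 0 < min w.re 1 := lt_min hw one_pos
  have hΩ := latticeSum_nonneg ha
  set F : (Fin M → ℕ) → ℝ → ℂ := fun n t =>
    (t : ℂ)⁻¹ * (expRem M w t * (Real.exp (-(latticeSum a n * t)) : ℝ)) with hF
  have hFi (n) : IntegrableOn (F n) (Ioi 0) := integrableOn_inv_mul_expRem M hw (hΩ n)
  have hsum : Summable fun n => ∫ t in Ioi 0, ‖F n t‖ := by
    refine Summable.of_nonneg_of_le (fun n => integral_nonneg fun t => norm_nonneg _) (fun n => ?_)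
      ((summable_add_latticeSum ha hm).mul_left (C * M.factorial))
    have hpos : 0 < min w.re 1 + latticeSum a n := by linarith [hΩ n]
    calc _ ≤ ∫ t in Ioi (0 : ℝ),
          C * (t ^ M * Real.exp (-((min w.re 1 + latticeSum a n) * t))) := by
          refine setIntegral_mono_on (hFi n).norm
            ((integrableOn_pow_mul_exp_neg_mul hpos M).const_mul C) measurableSet_Ioi
            fun t ht => norm_inv_mul_expRem_le h _ ht
      _ = _ := by
          rw [integral_const_mul, integral_pow_mul_exp_neg_mul hpos]; ring
  have hs := hasSum_integral_of_summable_integral_norm hFi hsum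
  have e : mellin (fun t => expRem M w t * (geomKernel a t : ℂ)) 0 =
      ∫ t in Ioi 0, ∑' n, F n t := by
    refine setIntegral_congr_fun measurableSet_Ioi fun t ht => ?_
    have hg := (hasSum_geomKernel ha (mem_Ioi.1 ht))
    have hg' : HasSum (fun n => ((Real.exp (-(latticeSum a n * t)) : ℝ) : ℂ))
      (geomKernel a t : ℂ) := by exact_mod_cast hg
    rw [hF]
    simp only [zero_sub, smul_eq_mul, Complex.cpow_neg_one]
    exact (((hg'.mul_left _).mul_left _).tsum_eq).symm
  rw [e, ← hs.tsum_eq]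
  exact tsum_congr fun n => integral_expRem M hw (hΩ n)

/-! ### Continuation of the Barnes zeta function and its derivative at `0`. -/

/-- `∏_{j=1}^M (s - j)` -/
def poleProd (M : ℕ) (s : ℂ) : ℂ := ∏ j ∈ Finset.Icc 1 M, (s - j)

theorem differentiable_poleProd (M : ℕ) : Differentiable ℂ (poleProd M) := by
  unfold poleProd; fun_prop

theorem poleProd_ne_zero {M : ℕ} {s : ℂ} (h : ∀ k ∈ Finset.Icc 1 M, s ≠ (k : ℂ)) :
    poleProd M s ≠ 0 :=
  Finset.prod_ne_zero_iff.2 fun k hk => sub_ne_zero.2 (h k hk)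

theorem Gamma_eq_poleProd_mul {M : ℕ} {s : ℂ} (hs : (M : ℝ) < s.re) :
    Complex.Gamma s = poleProd M s * Complex.Gamma (s - M) := by
  induction M with
  | zero => simp [poleProd]
  | succ M ih =>
    push_cast at hs
    have h1 : s - M - 1 ≠ 0 := fun h => by
      have := congrArg Complex.re h
      simp at this
      linarith
    have h2 := Complex.Gamma_add_one _ h1
    rw [sub_add_cancel] at h2
    rw [ih (by linarith), h2, poleProd, poleProd, Finset.prod_Icc_succ_top (by omega)]
    push_cast
    rw [show s - (M + 1 : ℂ) = s - M - 1 by ring]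
    ring

/-- The weights `t ^ k * exp (-w t) * ∏ j, (1 - exp (-a_j t))⁻¹`. -/
def weight {M : ℕ} (a : Fin M → ℝ) (k : ℕ) (w : ℂ) (t : ℝ) : ℂ :=
  (t : ℂ) ^ k * Complex.exp (-(w * t)) * (geomKernel a t : ℂ)

theorem continuousOn_weight {M : ℕ} {a : Fin M → ℝ} (ha : ∀ i, 0 < a i) (k : ℕ) (w : ℂ) :
    ContinuousOn (weight a k w) (Ioi 0) :=
  (Continuous.continuousOn (by fun_prop)).mul
    (Complex.continuous_ofReal.comp_continuousOn (continuousOn_geomKernel ha))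

theorem pow_mul_cexp_isBigO (k : ℕ) {w : ℂ} {δ : ℝ} (hδ : δ < w.re) :
    (fun t : ℝ => (t : ℂ) ^ k * Complex.exp (-(w * t))) =O[atTop]
      fun t => Real.exp (-δ * t) := by
  have h1 := (isLittleO_pow_exp_pos_mul_atTop k (sub_pos.2 hδ)).isBigO.mul
    (isBigO_refl (fun t : ℝ => Real.exp (-w.re * t)) atTop)
  refine (IsBigO.of_norm_left (?_ : (fun t : ℝ => ‖(t : ℂ) ^ k * Complex.exp (-(w * t))‖)
    =O[atTop] _))
  refine (h1.norm_left).congr (fun t => ?_) fun t => ?_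
  · simp [Complex.norm_exp]
  · rw [← Real.exp_add]; congr 1; ring

theorem weight_isBigO_atTop {M : ℕ} {a : Fin M → ℝ} (ha : ∀ i, 0 < a i) (k : ℕ) {w : ℂ} {δ : ℝ}
    (hδ : δ < w.re) : weight a k w =O[atTop] fun t => Real.exp (-δ * t) := by
  have := (pow_mul_cexp_isBigO k hδ).mul (Complex.isBigO_ofReal_left.2 (geomKernel_isBigO_atTop ha))
  simp only [mul_one] at this
  exact this

theorem mul_geomKernel_isBigO_zero {M : ℕ} {a : Fin M → ℝ} (ha : ∀ i, 0 < a i) {g : ℝ → ℂ} {m : ℕ}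
    (hg : g =O[𝓝[>] 0] fun t : ℝ => t ^ m) :
    (fun t => g t * (geomKernel a t : ℂ)) =O[𝓝[>] 0] fun t : ℝ => t ^ (-((M : ℝ) - m)) := by
  refine (hg.mul (Complex.isBigO_ofReal_left.2 (geomKernel_isBigO_zero ha))).congr'
    EventuallyEq.rfl ?_
  filter_upwards [self_mem_nhdsWithin] with t ht
  have ht := mem_Ioi.1 ht
  rw [← Real.rpow_natCast, ← Real.rpow_add ht]
  congr 1; ring

theorem mellinConvergent_weight {M : ℕ} {a : Fin M → ℝ} (ha : ∀ i, 0 < a i) (k : ℕ) {w s : ℂ}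
    (hw : 0 < w.re) (hs : (M : ℝ) < s.re) : MellinConvergent (weight a k w) s := by
  have h1 : (fun t : ℝ => (t : ℂ) ^ k * Complex.exp (-(w * t))) =O[𝓝[>] 0]
      fun t : ℝ => t ^ 0 := by
    simp only [pow_zero]
    have : ContinuousAt (fun t : ℝ => (t : ℂ) ^ k * Complex.exp (-(w * t))) 0 := by fun_prop
    exact (this.isBigO_one ℝ).mono nhdsWithin_le_nhds
  refine mellinConvergent_of_isBigO_rpow_exp (half_pos hw)
    ((continuousOn_weight ha k w).locallyIntegrableOn measurableSet_Ioi)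
    (weight_isBigO_atTop ha k (half_lt_self hw)) (mul_geomKernel_isBigO_zero ha h1) ?_
  simpa using hs

/-- Multiplied by `∏_{j=1}^M (s - j)`, the normalized Mellin transforms of the weights are
entire. -/
theorem exists_entire_weight {M : ℕ} {a : Fin M → ℝ} (ha : ∀ i, 0 < a i) (k : ℕ) {w : ℂ}
    (hw : 0 < w.re) : ∃ E : ℂ → ℂ, Differentiable ℂ E ∧ ∀ s : ℂ, (M : ℝ) < s.re →
      E s = poleProd M s * ((Complex.Gamma s)⁻¹ * mellin (weight a k w) s) := by
  -- The factor `t ^ M` cancels the pole of the kernel at `t = 0`. It shifts the Mellin variable to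
  -- `s - M`, and `Γ(s) = ∏ (s - j) · Γ(s - M)` accounts for the normalization.
  obtain ⟨E, hE, he⟩ := exists_entire_mellin (G := fun t => (t : ℂ) ^ M * weight a k w t)
    (G₀ := fun t => (t : ℂ) ^ k * Complex.exp (-(w * t)) * (smoothKernel a t : ℂ))
    (half_pos hw) ((Continuous.continuousOn (by fun_prop)).mul (continuousOn_weight ha k w))
    ((weight_isBigO_atTop (a := a) ha (k + M) (half_lt_self hw)).congr_left fun t => by
      simp only [weight]; ring)
    (by
      have h1 : AnalyticAt ℝ (fun t : ℝ => (smoothKernel a t : ℂ)) 0 :=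
        (Complex.ofRealCLM.analyticAt _).comp (analyticAt_smoothKernel ha)
      have h2 : AnalyticAt ℝ (fun t : ℝ => (t : ℂ)) 0 := Complex.ofRealCLM.analyticAt _
      have h4 : AnalyticAt ℝ (fun t : ℝ => -(w * (t : ℂ))) 0 := (analyticAt_const.mul h2).neg
      have h3 : AnalyticAt ℝ (fun t : ℝ => Complex.exp (-(w * t))) 0 :=
        AnalyticAt.comp (g := Complex.exp) analyticAt_cexp.restrictScalars h4
      exact ((h2.pow k).mul h3).mul h1)
    (fun t ht => by
      simp only [weight, smoothKernel_eq a (mem_Ioi.1 ht)]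
      push_cast
      ring)
  refine ⟨fun s => E (s - M), by fun_prop, fun s hs => ?_⟩
  have h1 : s - M ∈ {u : ℂ | 0 < u.re} := by simpa using hs
  have h2 : mellin (fun t => (t : ℂ) ^ M * weight a k w t) (s - M) = mellin (weight a k w) s := by
    have := mellin_cpow_smul (weight a k w) (s - M) M
    simpa using this
  have h3 : poleProd M s ≠ 0 := poleProd_ne_zero fun k hk h => by
    rw [h] at hs
    simp at hs
    have := (Finset.mem_Icc.1 hk).2
    omega
  simp only [he h1]
  rw [h2, Gamma_eq_poleProd_mul hs, mul_inv, ← mul_assoc, ← mul_assoc,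
    mul_inv_cancel₀ h3, one_mul]

theorem barnesZetaIntegral_eq {M : ℕ} (a : Fin M → ℝ) (w s : ℂ) :
    barnesZetaIntegral a w s = (Complex.Gamma s)⁻¹ * mellin (weight a 0 w) s := by
  rw [barnesZetaIntegral, mellin]
  congr 1
  refine setIntegral_congr_fun measurableSet_Ioi fun t ht => ?_
  have ht0 : t ^ M ≠ 0 := pow_ne_zero _ (mem_Ioi.1 ht).ne'
  have : barnesKernel a t / t ^ M = geomKernel a t := by
    rw [barnesKernel, mul_div_cancel_left₀ _ ht0, geomKernel]
  simp only [this, weight, pow_zero, one_mul, smul_eq_mul, mul_assoc]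

theorem isOpen_poleFree (M : ℕ) : IsOpen {s : ℂ | ∀ k ∈ Finset.Icc 1 M, s ≠ (k : ℂ)} := by
  have : {s : ℂ | ∀ k ∈ Finset.Icc 1 M, s ≠ (k : ℂ)} =
      (((Finset.Icc 1 M).image fun k : ℕ => (k : ℂ) : Finset ℂ) : Set ℂ)ᶜ := by
    ext s; simp [eq_comm]
  rw [this]
  exact (Finset.finite_toSet _).isClosed.isOpen_compl

theorem isPreconnected_poleFree (M : ℕ) :
    IsPreconnected {s : ℂ | ∀ k ∈ Finset.Icc 1 M, s ≠ (k : ℂ)} := by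
  have : {s : ℂ | ∀ k ∈ Finset.Icc 1 M, s ≠ (k : ℂ)} =
      (((Finset.Icc 1 M).image fun k : ℕ => (k : ℂ) : Finset ℂ) : Set ℂ)ᶜ := by
    ext s; simp [eq_comm]
  rw [this]
  exact ((Finset.finite_toSet _).countable.isConnected_compl_of_one_lt_rank (by simp)).2

theorem isOpen_re_gt (c : ℝ) : IsOpen {s : ℂ | c < s.re} :=
  isOpen_lt continuous_const Complex.continuous_re

theorem barnesZeta_eqOn {M : ℕ} {a : Fin M → ℝ} {w : ℂ} {E : ℂ → ℂ} (hE : Differentiable ℂ E)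
    (he : ∀ s : ℂ, (M : ℝ) < s.re →
      E s = poleProd M s * ((Complex.Gamma s)⁻¹ * mellin (weight a 0 w) s)) :
    EqOn (barnesZeta a w) (fun s => E s / poleProd M s)
      {s | ∀ k ∈ Finset.Icc 1 M, s ≠ (k : ℂ)} := by
  have hsub : {s : ℂ | (M : ℝ) < s.re} ⊆ {s | ∀ k ∈ Finset.Icc 1 M, s ≠ (k : ℂ)} := by
    intro s hs k hk h
    rw [h] at hs
    simp at hs
    have := (Finset.mem_Icc.1 hk).2
    omega
  refine holomorphicExtension_eqOn (isOpen_poleFree M) (isPreconnected_poleFree M)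
    (isOpen_re_gt M) ⟨((M + 1 : ℕ) : ℂ), by simp⟩ hsub ?_ ?_
  · intro s hs
    exact (hE.differentiableAt.div (differentiable_poleProd M).differentiableAt
      (poleProd_ne_zero hs)).differentiableWithinAt
  · intro s hs
    simp only [he s hs]
    rw [mul_div_cancel_left₀ _ (poleProd_ne_zero (hsub hs)), barnesZetaIntegral_eq]

theorem expRem_isBigO_atTop {M : ℕ} {w : ℂ} {δ : ℝ} (hδ : δ < w.re) (hδ1 : δ < 1) :
    expRem M w =O[atTop] fun t => Real.exp (-δ * t) := by
  have h1 := pow_mul_cexp_isBigO 0 hδ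
  simp only [pow_zero, one_mul] at h1
  refine h1.sub ?_
  simp only [Finset.mul_sum]
  refine IsBigO.fun_sum fun k _ => ?_
  have h2 := (pow_mul_cexp_isBigO k (w := 1) (by simpa using hδ1)).const_mul_left
    ((-(w - 1)) ^ k / (k.factorial : ℂ))
  refine h2.congr_left fun t => ?_
  rw [one_mul, show -((w - 1) * (t : ℂ)) = -(w - 1) * t by ring, mul_pow]
  ring

theorem expRem_isBigO_zero (M : ℕ) (w : ℂ) :
    expRem M w =O[𝓝[>] 0] fun t : ℝ => t ^ (M + 1) := by
  obtain ⟨C, hC, h⟩ := exists_norm_expRem_le M w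
  have h1 : (fun t : ℝ => Real.exp (-(min w.re 1 * t))) =O[𝓝[>] 0] fun _ => (1 : ℝ) := by
    have : ContinuousAt (fun t : ℝ => Real.exp (-(min w.re 1 * t))) 0 := by fun_prop
    exact (this.isBigO_one ℝ).mono nhdsWithin_le_nhds
  have h2 := ((isBigO_refl (fun t : ℝ => t ^ (M + 1)) (𝓝[>] 0)).mul h1).const_mul_left C
  simp only [mul_one] at h2
  refine IsBigO.trans (IsBigO.of_norm_eventuallyLE ?_) h2
  filter_upwards [self_mem_nhdsWithin] with t ht using h t ht

theorem expRem_mul_geomKernel {M : ℕ} (a : Fin M → ℝ) (w : ℂ) (t : ℝ) :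
    expRem M w t * (geomKernel a t : ℂ) = weight a 0 w t -
      ∑ k ∈ Finset.range (M + 1), ((-(w - 1)) ^ k / (k.factorial : ℂ)) • weight a k 1 t := by
  rw [expRem, sub_mul, weight, pow_zero, one_mul, Finset.mul_sum, Finset.sum_mul]
  congr 1
  refine Finset.sum_congr rfl fun k _ => ?_
  rw [weight, smul_eq_mul, show -((w - 1) * (t : ℂ)) = -(w - 1) * t by ring, mul_pow, one_mul]
  ring

theorem mellin_expRem_mul_geomKernel {M : ℕ} {a : Fin M → ℝ} (ha : ∀ i, 0 < a i) {w s : ℂ}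
    (hw : 0 < w.re) (hs : (M : ℝ) < s.re) :
    mellin (fun t => expRem M w t * (geomKernel a t : ℂ)) s = mellin (weight a 0 w) s -
      ∑ k ∈ Finset.range (M + 1),
        ((-(w - 1)) ^ k / (k.factorial : ℂ)) * mellin (weight a k 1) s := by
  have hS : ∀ n : ℕ, HasMellin (fun t => ∑ k ∈ Finset.range n,
      ((-(w - 1)) ^ k / (k.factorial : ℂ)) • weight a k 1 t) s
        (∑ k ∈ Finset.range n,
        ((-(w - 1)) ^ k / (k.factorial : ℂ)) * mellin (weight a k 1) s) := by
    intro n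
    induction n with
    | zero => simp [HasMellin, MellinConvergent, mellin]
    | succ n ih =>
      simp only [Finset.sum_range_succ]
      have h2 := hasMellin_const_smul
        (mellinConvergent_weight ha n (w := 1) (by simp) hs) ((-(w - 1)) ^ n / (n.factorial : ℂ))
      have h3 := hasMellin_add ih.1 h2.1
      rw [ih.2, h2.2] at h3
      exact h3
  have h1 := hS (M + 1)
  have h4 := (hasMellin_sub (mellinConvergent_weight ha 0 hw hs) h1.1).2
  rw [h1.2] at h4
  rw [← h4]
  congr 1
  ext t
  exact expRem_mul_geomKernel a w t

/-- `1 / Γ(s) = s / Γ(s + 1)` has a simple zero at `0` with derivative `1`, so only the value `h 0`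
survives. -/
theorem deriv_Gamma_inv_mul {h : ℂ → ℂ} (hh : DifferentiableAt ℂ h 0) :
    HasDerivAt (fun s => (Complex.Gamma s)⁻¹ * h s) (h 0) 0 := by
  have h1 : DifferentiableAt ℂ (fun s : ℂ => (Complex.Gamma (s + 1))⁻¹ * h s) 0 :=
    (Complex.differentiable_one_div_Gamma.differentiableAt.comp (f := fun s : ℂ => s + 1) 0
      (by fun_prop)).mul hh
  have h2 := (hasDerivAt_id (0 : ℂ)).mul h1.hasDerivAt
  simp only [id, zero_add, Complex.Gamma_one, inv_one, one_mul, zero_mul, add_zero] at h2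
  refine h2.congr_of_eventuallyEq (Eventually.of_forall fun s => ?_)
  simp only [Pi.mul_apply, id]
  rw [Complex.one_div_Gamma_eq_self_mul_one_div_Gamma_add_one, mul_assoc]

/-- The derivative of the Barnes zeta function at `s = 0` is a polynomial in `w` plus a
convergent series of regularized logarithms. -/
theorem exists_deriv_barnesZeta {M : ℕ} {a : Fin M → ℝ} (ha : ∀ i, 0 < a i) :
    ∃ c : ℕ → ℂ, ∀ w : ℂ, 0 < w.re → deriv (barnesZeta a w) 0 =
      ∑ k ∈ Finset.range (M + 1), c k * (w - 1) ^ k + ∑' n, regTerm M w (latticeSum a n) := by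
  choose E hE he using fun k : ℕ => exists_entire_weight ha k (w := 1) (by simp)
  set D : ℕ → ℂ → ℂ := fun k s => E k s / poleProd M s
  have h0U : (0 : ℂ) ∈ {s : ℂ | ∀ k ∈ Finset.Icc 1 M, s ≠ (k : ℂ)} := by
    intro k hk h
    have := (Finset.mem_Icc.1 hk).1
    have h : k = 0 := by exact_mod_cast h.symm
    omega
  have hD (k : ℕ) : DifferentiableAt ℂ (D k) 0 :=
    (hE k).differentiableAt.div (differentiable_poleProd M).differentiableAt (poleProd_ne_zero h0U)
  refine ⟨fun k => (-1) ^ k / (k.factorial : ℂ) * deriv (D k) 0, fun w hw => ?_⟩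
  obtain ⟨F, hF, hf⟩ := exists_entire_weight ha 0 hw
  set R : ℝ → ℂ := fun t => expRem M w t * (geomKernel a t : ℂ) with hR
  -- At `0` the integrand is `O(t ^ (M + 1)) · O(t ^ (-M)) = O(t)`, so the Mellin integral is
  -- holomorphic beyond `s = 0`.
  have hRd {s : ℂ} (hs : -1 < s.re) : DifferentiableAt ℂ (mellin R) s := by
    have hδ : 0 < min w.re 1 / 2 := half_pos (lt_min hw one_pos)
    have h1 : min w.re 1 / 2 < w.re := (half_lt_self (lt_min hw one_pos)).trans_le (min_le_left _ _)
    have h2 : min w.re 1 / 2 < 1 := (half_lt_self (lt_min hw one_pos)).trans_le (min_le_right _ _)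
    have h3 := (expRem_isBigO_atTop (M := M) h1 h2).mul
      (Complex.isBigO_ofReal_left.2 (geomKernel_isBigO_atTop ha))
    simp only [mul_one] at h3
    refine mellin_differentiableAt_of_isBigO_rpow_exp hδ
      (((continuous_expRem M w).continuousOn.mul (Complex.continuous_ofReal.comp_continuousOn
        (continuousOn_geomKernel ha))).locallyIntegrableOn measurableSet_Ioi) h3
        (mul_geomKernel_isBigO_zero ha (expRem_isBigO_zero M w)) ?_
    push_cast
    linarith
  -- For `Re s > M` this is the Taylor splitting of `e^{-wt}`. After multiplication by `poleProd`
  -- both sides are holomorphic for `Re s > -1`, and the identity theorem carries it to a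
  -- neighbourhood of `0`. The `E k` are independent of `w`, hence the polynomial dependence on `w`.
  have hext : EqOn F (fun s => ∑ k ∈ Finset.range (M + 1),
      ((-(w - 1)) ^ k / (k.factorial : ℂ)) * E k s +
        poleProd M s * ((Complex.Gamma s)⁻¹ * mellin R s)) {s | -1 < s.re} := by
    refine AnalyticOnNhd.eqOn_of_preconnected_of_eventuallyEq
      (hF.differentiableOn.analyticOnNhd (isOpen_re_gt _))
      (DifferentiableOn.analyticOnNhd (fun s hs => ?_) (isOpen_re_gt _))
      (convex_halfSpace_re_gt (-1)).isPreconnected (z₀ := ((M + 1 : ℕ) : ℂ)) ?_ ?_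
    · refine DifferentiableAt.differentiableWithinAt ?_
      refine (DifferentiableAt.fun_sum fun k _ => (hE k).differentiableAt.const_mul _).add ?_
      exact (differentiable_poleProd M).differentiableAt.mul
        (Complex.differentiable_one_div_Gamma.differentiableAt.mul (hRd hs))
    · have : (0 : ℝ) ≤ M := by positivity
      simp only [mem_ofPred_eq, Complex.natCast_re]
      push_cast
      linarith
    · filter_upwards [(isOpen_re_gt M).mem_nhds
        (by simp : ((M + 1 : ℕ) : ℂ) ∈ {s : ℂ | (M : ℝ) < s.re})] with s hs
      rw [hf s hs, hR, mellin_expRem_mul_geomKernel ha hw hs, mul_sub, mul_sub, Finset.mul_sum,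
        Finset.mul_sum]
      rw [← add_sub_assoc, eq_sub_iff_add_eq, add_comm]
      congr 1
      refine Finset.sum_congr rfl fun k _ => ?_
      rw [he k s hs]
      ring
  have hnear : barnesZeta a w =ᶠ[𝓝 0] fun s => ∑ k ∈ Finset.range (M + 1),
      ((-(w - 1)) ^ k / (k.factorial : ℂ)) * D k s + (Complex.Gamma s)⁻¹ * mellin R s := by
    filter_upwards [(isOpen_poleFree M).mem_nhds h0U, (isOpen_re_gt (-1)).mem_nhds
      (by simp : (0 : ℂ) ∈ {s : ℂ | -1 < s.re})] with s hs1 hs2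
    have hp := poleProd_ne_zero hs1
    rw [barnesZeta_eqOn hF hf hs1]
    simp only [hext hs2, add_div, Finset.sum_div, D]
    congr 1
    · exact Finset.sum_congr rfl fun k _ => by ring
    · rw [mul_div_cancel_left₀ _ hp]
  rw [hnear.deriv_eq]
  have hd := (HasDerivAt.fun_sum (u := Finset.range (M + 1)) fun k _ =>
    ((hD k).hasDerivAt.const_mul ((-(w - 1)) ^ k / (k.factorial : ℂ)))).add
      (deriv_Gamma_inv_mul (hRd (s := 0) (by simp)))
  refine hd.deriv.trans ?_
  rw [hR, mellin_expRem_zero ha hw]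
  congr 1
  refine Finset.sum_congr rfl fun k _ => ?_
  rw [neg_pow]
  ring

theorem exists_barnesLogGamma_eq {M : ℕ} {a : Fin M → ℝ} (ha : ∀ i, 0 < a i) :
    ∃ c : ℕ → ℂ, EqOn (barnesLogGamma a) (fun w =>
      ∑ k ∈ Finset.range (M + 1), c k * (w - 1) ^ k + ∑' n, regTerm M w (latticeSum a n))
      Complex.slitPlane := by
  obtain ⟨c, hc⟩ := exists_deriv_barnesZeta ha
  refine ⟨c, holomorphicExtension_eqOn Complex.isOpen_slitPlane ?_ (isOpen_re_gt 0)
    ⟨1, by simp⟩ (fun w hw => Or.inl hw) ?_ fun w hw => (hc w hw).symm⟩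
  · exact (Complex.starConvex_one_slitPlane.isPathConnected
      Complex.one_mem_slitPlane).isConnected.isPreconnected
  · exact DifferentiableOn.add (by fun_prop) (differentiableOn_tsum_regTerm ha)

/-! ### Finite differences and the product formula. -/

theorem _root_.Polynomial.degree_comp_X_add_C_sub_lt {P : Polynomial ℂ} (hP : P ≠ 0) (r : ℂ) :
    (P.comp (Polynomial.X + Polynomial.C r) - P).degree < P.degree := by
  have h0 : P.comp (Polynomial.X + Polynomial.C r) = P.taylor r := rfl
  rw [h0, ← Polynomial.degree_taylor P r]
  refine Polynomial.degree_sub_lt_left (Polynomial.degree_taylor P r) ?_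
    (Polynomial.leadingCoeff_taylor r P)
  rwa [← Polynomial.degree_ne_bot, Polynomial.degree_taylor, Polynomial.degree_ne_bot]

/-- The alternating sum over all subsets of `T` kills polynomials of degree less than `#T`. -/
theorem sum_powerset_eval_eq_zero {ι : Type*} [DecidableEq ι] (b : ι → ℂ) (T : Finset ι)
    (P : Polynomial ℂ) (hP : P.degree < T.card) (x : ℂ) :
    ∑ s ∈ T.powerset, (-1 : ℂ) ^ s.card * P.eval (x + ∑ j ∈ s, b j) = 0 := by
  induction T using Finset.induction_on generalizing P x with
  | empty =>
    have : P = 0 := by simpa [Nat.WithBot.lt_zero_iff] using hP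
    simp [this]
  | insert j T hj ih =>
    by_cases h0 : P = 0
    · simp [h0]
    -- Pairing `s` with `s ∪ {j}` turns the sum into minus the same sum over `T` for `P(· + b_j) -
    -- P`, whose degree is smaller.
    rw [Finset.sum_powerset_insert hj]
    have hd := Polynomial.degree_comp_X_add_C_sub_lt h0 (b j)
    rw [Finset.card_insert_of_notMem hj] at hP
    have hlt : (P.comp (Polynomial.X + Polynomial.C (b j)) - P).degree < T.card := by
      rw [Polynomial.degree_eq_natDegree h0] at hP hd
      refine hd.trans_le ?_
      have : P.natDegree < T.card + 1 := by exact_mod_cast hP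
      exact_mod_cast Nat.lt_succ_iff.1 this
    have := ih _ hlt x
    rw [← neg_eq_zero, ← this, ← Finset.sum_add_distrib, ← Finset.sum_neg_distrib]
    refine Finset.sum_congr rfl fun s hs => ?_
    have hjs : j ∉ s := fun h => hj (Finset.mem_powerset.1 hs h)
    rw [Finset.card_insert_of_notMem hjs, Finset.sum_insert hjs]
    simp only [Polynomial.eval_sub, Polynomial.eval_comp, Polynomial.eval_add, Polynomial.eval_X,
      Polynomial.eval_C]
    rw [show x + (b j + ∑ j ∈ s, b j) = x + ∑ j ∈ s, b j + b j by ring]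
    ring

/-- `P(· + q) - P` has degree less than `N`, so the alternating sum over subsets kills it. -/
theorem opS_polynomial {N : ℕ} (b : Fin (N + 1) → ℝ) (P : Polynomial ℂ) (hP : P.natDegree ≤ N)
    (q : ℂ) : opS (fun w => P.eval w) b q = opS (fun w => P.eval w) b 0 := by
  by_cases h0 : P = 0
  · simp [opS, h0]
  have h1 : (P.comp (Polynomial.X + Polynomial.C q) - P).degree <
      ((Finset.univ : Finset (Fin N)).card : WithBot ℕ) := by
    refine (Polynomial.degree_comp_X_add_C_sub_lt h0 q).trans_le ?_
    rw [Polynomial.degree_eq_natDegree h0]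
    simpa using hP
  have h2 := sum_powerset_eval_eq_zero (fun j => (b (Fin.succ j) : ℂ)) Finset.univ _ h1 (b 0)
  rw [Finset.powerset_univ] at h2
  rw [← sub_eq_zero, opS, opS, ← Finset.sum_sub_distrib]
  refine Eq.trans ?_ h2
  refine Finset.sum_congr rfl fun s _ => ?_
  simp only [shift, Polynomial.eval_sub, Polynomial.eval_comp, Polynomial.eval_add,
    Polynomial.eval_X, Polynomial.eval_C]
  push_cast
  rw [add_comm q, zero_add, mul_sub]

theorem opS_sum_pow {N M : ℕ} (hMN : M ≤ N) (b : Fin (N + 1) → ℝ) (c : ℕ → ℂ) (q : ℂ) :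
    opS (fun w => ∑ k ∈ Finset.range (M + 1), c k * (w - 1) ^ k) b q =
      opS (fun w => ∑ k ∈ Finset.range (M + 1), c k * (w - 1) ^ k) b 0 := by
  set P : Polynomial ℂ := ∑ k ∈ Finset.range (M + 1),
    Polynomial.C (c k) * (Polynomial.X - Polynomial.C 1) ^ k
  have hP : P.natDegree ≤ N := by
    refine Polynomial.natDegree_sum_le_of_forall_le _ _ fun k hk => ?_
    refine (Polynomial.natDegree_C_mul_le _ _).trans ?_
    rw [Polynomial.natDegree_pow, Polynomial.natDegree_X_sub_C, mul_one]
    have := Finset.mem_range.1 hk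
    omega
  have := opS_polynomial b P hP q
  simpa [P, Polynomial.eval_finsetSum] using this

theorem shift_pos {N : ℕ} {b : Fin (N + 1) → ℝ} (hb : ∀ i, 0 < b i) (s : Finset (Fin N)) :
    0 < shift b s :=
  add_pos_of_pos_of_nonneg (hb 0) (Finset.sum_nonneg fun _ _ => (hb _).le)

theorem add_shift_mem_slitPlane {N : ℕ} {b : Fin (N + 1) → ℝ} (hb : ∀ j, 0 < b j) {q : ℂ}
    (hq : q ∉ ((↑) : ℝ → ℂ) '' Iic (-b 0)) (s : Finset (Fin N)) :
    q + shift b s ∈ Complex.slitPlane := by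
  rw [Complex.mem_slitPlane_iff]
  by_cases him : q.im = 0
  · left
    by_contra hcon
    simp only [Complex.add_re, Complex.ofReal_re, not_lt] at hcon
    refine hq ⟨q.re, ?_, Complex.ext (by simp) (by simp [him])⟩
    have : b 0 ≤ shift b s := le_add_of_nonneg_right (Finset.sum_nonneg fun j _ => (hb _).le)
    simp only [mem_Iic]
    linarith
  · right
    simpa using him

theorem zero_notMem_cut {N : ℕ} {b : Fin (N + 1) → ℝ} (hb : ∀ j, 0 < b j) :
    (0 : ℂ) ∉ ((↑) : ℝ → ℂ) '' Iic (-b 0) := by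
  rintro ⟨x, hx, h⟩
  have h : x = 0 := by exact_mod_cast h
  have := hb 0
  rw [h, mem_Iic] at hx
  linarith

theorem _root_.Complex.exp_neg_one_pow_mul_log_sub {x y : ℂ} (hx : x ≠ 0) (hy : y ≠ 0) (k : ℕ) :
    Complex.exp ((-1) ^ k * (Complex.log y - Complex.log x)) = (x / y) ^ ((-1 : ℤ) ^ (k + 1)) := by
  rcases Nat.even_or_odd k with h | h
  · rw [h.neg_one_pow, h.add_one.neg_one_pow, one_mul, Complex.exp_sub, Complex.exp_log hy,
      Complex.exp_log hx, zpow_neg_one, inv_div]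
  · rw [h.neg_one_pow, h.add_one.neg_one_pow, neg_one_mul, neg_sub, Complex.exp_sub,
      Complex.exp_log hy, Complex.exp_log hx, zpow_one]

/-- The Taylor polynomial has degree at most `M ≤ N` in `w` and cancels between `q` and `0`. The
logarithms remain, and the normalization `1 + Ω` cancels in each ratio. -/
theorem exp_opS_regTerm {M N : ℕ} (hMN : M ≤ N) {b : Fin (N + 1) → ℝ} (hb : ∀ j, 0 < b j) {q : ℂ}
    (hq : q ∉ ((↑) : ℝ → ℂ) '' Iic (-b 0)) {Ω : ℝ} (hΩ : 0 ≤ Ω) :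
    Complex.exp (opS (regTerm M · Ω) b q - opS (regTerm M · Ω) b 0) = barnesFactor b q Ω := by
  have h1Ω : (1 : ℂ) + Ω ≠ 0 := by
    have : (1 : ℝ) + Ω ≠ 0 := by positivity
    exact_mod_cast this
  -- The coefficient at `k = 0` is `0` by division by zero, matching `logTaylor`.
  set c : ℕ → ℂ := fun k => (-1) ^ (k + 1) / k / (1 + Ω) ^ k with hc
  have hreg (w : ℂ) : regTerm M w Ω = -Complex.log (1 + (w - 1) / (1 + Ω)) +
      ∑ k ∈ Finset.range (M + 1), c k * (w - 1) ^ k := by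
    rw [regTerm, neg_sub, sub_eq_neg_add, Complex.logTaylor]
    congr 1
    refine Finset.sum_congr rfl fun k _ => ?_
    rw [hc, div_pow]
    ring
  have hsplit (p : ℂ) : opS (regTerm M · Ω) b p =
      opS (fun w => -Complex.log (1 + (w - 1) / (1 + Ω))) b p +
      opS (fun w => ∑ k ∈ Finset.range (M + 1), c k * (w - 1) ^ k) b p := by
    simp only [opS, hreg, mul_add, Finset.sum_add_distrib]
  rw [hsplit, hsplit, opS_sum_pow hMN b c q, add_sub_add_right_eq_sub, opS, opS,
    ← Finset.sum_sub_distrib, Complex.exp_sum, barnesFactor]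
  refine Finset.prod_congr rfl fun s _ => ?_
  have e (w : ℂ) : 1 + (w - 1) / (1 + Ω) = (w + Ω) / (1 + Ω) := by
    field_simp; ring
  have hx := Complex.slitPlane_ne_zero
    (one_add_div_mem_slitPlane (add_shift_mem_slitPlane hb hq s) hΩ)
  have hy := Complex.slitPlane_ne_zero
    (one_add_div_mem_slitPlane (add_shift_mem_slitPlane hb (zero_notMem_cut hb) s) hΩ)
  rw [← mul_sub, neg_sub_neg, Complex.exp_neg_one_pow_mul_log_sub hx hy, e, e, zero_add,
    div_div_div_cancel_right₀ h1Ω]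

theorem hasProd_barnesFactor {M N : ℕ} (hMN : M ≤ N) {a : Fin M → ℝ} (ha : ∀ i, 0 < a i)
    {b : Fin (N + 1) → ℝ} (hb : ∀ j, 0 < b j) {q : ℂ}
    (hq : q ∉ ((↑) : ℝ → ℂ) '' Iic (-b 0)) :
    HasProd (fun n : Fin M → ℕ => barnesFactor b q (latticeSum a n)) (eta a b q) := by
  obtain ⟨c, hc⟩ := exists_barnesLogGamma_eq ha
  have key {p : ℂ} (hp : p ∉ ((↑) : ℝ → ℂ) '' Iic (-b 0)) :
      HasSum (fun n => opS (regTerm M · (latticeSum a n)) b p)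
        (opS (barnesLogGamma a) b p -
          opS (fun w => ∑ k ∈ Finset.range (M + 1), c k * (w - 1) ^ k) b p) := by
    have h1 (s : Finset (Fin N)) : HasSum
        (fun n => (-1 : ℂ) ^ s.card * regTerm M (p + shift b s) (latticeSum a n))
        ((-1 : ℂ) ^ s.card * barnesLogGamma a (p + shift b s) - (-1 : ℂ) ^ s.card *
          ∑ k ∈ Finset.range (M + 1), c k * (p + shift b s - 1) ^ k) := by
      have := (summable_regTerm ha (p + shift b s)).hasSum
      rw [← mul_sub, hc (add_shift_mem_slitPlane hb hp s), add_sub_cancel_left]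
      exact this.mul_left _
    have := hasSum_sum (s := Finset.univ) fun s _ => h1 s
    rw [Finset.sum_sub_distrib] at this
    exact this
  have h := ((key hq).sub (key (zero_notMem_cut hb))).cexp
  rw [opS_sum_pow hMN b c q, sub_sub_sub_cancel_right] at h
  exact h.congr_fun fun n => (exp_opS_regTerm hMN hb hq (latticeSum_nonneg ha n)).symm

/-- For `M = 0` the lattice is a single point with `Ω = 0`, so the product has one factor. -/
theorem eta_elim0 {N : ℕ} {b : Fin (N + 1) → ℝ} (hb : ∀ j, 0 < b j) {q : ℂ}
    (hq : q ∉ ((↑) : ℝ → ℂ) '' Iic (-b 0)) :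
    eta (Fin.elim0 : Fin 0 → ℝ) b q = barnesFactor b q 0 := by
  have h := hasProd_barnesFactor (Nat.zero_le N) (a := (Fin.elim0 : Fin 0 → ℝ))
    (fun i => i.elim0) hb hq
  have e : (fun n : Fin 0 → ℕ => barnesFactor b q (latticeSum Fin.elim0 n)) =
      fun _ => barnesFactor b q 0 := by
    ext n; simp [latticeSum]
  rw [e] at h
  exact h.unique (hasProd_unique _)

theorem barnesFactor_update {N : ℕ} (b : Fin (N + 1) → ℝ) (q : ℂ) (Ω : ℝ) :
    barnesFactor (Function.update b 0 (b 0 + Ω)) q 0 = barnesFactor b q Ω := by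
  have h (s : Finset (Fin N)) : shift (Function.update b 0 (b 0 + Ω)) s = shift b s + Ω := by
    simp only [shift, Function.update_self, Function.update_of_ne (Fin.succ_ne_zero _)]
    ring
  simp only [barnesFactor, h]
  push_cast
  simp only [add_zero, add_assoc]

/-- Absorbing `Ω` into `b_0` identifies each factor of the product with the Mellin transform of a
`β_{0,N}` law. -/
theorem eta_update {N : ℕ} {b : Fin (N + 1) → ℝ} (hb : ∀ j, 0 < b j) {Ω : ℝ} (hΩ : 0 ≤ Ω) {q : ℂ}
    (hq : q ∉ ((↑) : ℝ → ℂ) '' Iic (-b 0)) :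
    eta (Fin.elim0 : Fin 0 → ℝ) (Function.update b 0 (b 0 + Ω)) q = barnesFactor b q Ω := by
  rw [eta_elim0, barnesFactor_update]
  · intro j
    rcases eq_or_ne j 0 with rfl | hj
    · simpa using add_pos_of_pos_of_nonneg (hb 0) hΩ
    · simpa [Function.update_of_ne hj] using hb j
  · rintro ⟨x, hx, rfl⟩
    refine hq ⟨x, ?_, rfl⟩
    simp only [Function.update_self, mem_Iic] at hx ⊢
    linarith

/-! ### Compound Poisson laws and the existence of `β_{0,N}`. -/

theorem isBarnesBetaLaw_map_exp_neg {M N : ℕ} {a : Fin M → ℝ} {b : Fin (N + 1) → ℝ}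
    {m : Measure ℝ} [IsProbabilityMeasure m] (h0 : ∀ᵐ t ∂m, 0 ≤ t)
    (hi : ∀ q : ℂ, -b 0 < q.re → Integrable (fun t : ℝ => Complex.exp (-(q * t))) m)
    (he : ∀ q : ℂ, -b 0 < q.re → ∫ t : ℝ, Complex.exp (-(q * t)) ∂m = eta a b q) :
    IsBarnesBetaLaw a b (m.map fun t => Real.exp (-t)) := by
  have hm : Measurable fun t : ℝ => Real.exp (-t) := by fun_prop
  have hc (q : ℂ) (t : ℝ) : ((Real.exp (-t) : ℝ) : ℂ) ^ q = Complex.exp (-(q * t)) := by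
    rw [Complex.cpow_def_of_ne_zero (by exact_mod_cast (Real.exp_pos _).ne'), ← Complex.ofReal_log
      (Real.exp_pos _).le, Real.log_exp]
    congr 1; push_cast; ring
  have hq (q : ℂ) : Measurable fun x : ℝ => (x : ℂ) ^ q := by fun_prop
  refine ⟨Measure.isProbabilityMeasure_map hm.aemeasurable, ?_, fun q hq' => ?_, fun q hq' => ?_⟩
  · rw [Measure.map_apply hm measurableSet_Ioc.compl]
    refine measure_mono_null ?_ (ae_iff.1 h0)
    intro t ht h
    refine ht ⟨Real.exp_pos _, ?_⟩
    rw [Real.exp_le_one_iff]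
    linarith
  · rw [integrable_map_measure (hq q).aestronglyMeasurable hm.aemeasurable]
    exact (hi q hq').congr (Eventually.of_forall fun t => (hc q t).symm)
  · rw [integral_map hm.aemeasurable (hq q).aestronglyMeasurable, ← he q hq']
    simp only [hc]

/-- Convolution powers of a measure on the line. -/
def convPow (ν : Measure ℝ) : ℕ → Measure ℝ
  | 0 => Measure.dirac 0
  | k + 1 => (convPow ν k).conv ν

instance (ν : Measure ℝ) [IsFiniteMeasure ν] (k : ℕ) : IsFiniteMeasure (convPow ν k) := by
  induction k with
  | zero => rw [convPow]; infer_instance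
  | succ k ih => rw [convPow]; infer_instance

theorem lintegral_exp_convPow (ν : Measure ℝ) [IsFiniteMeasure ν] (σ : ℝ) (k : ℕ) :
    ∫⁻ t, ENNReal.ofReal (Real.exp (-(σ * t))) ∂(convPow ν k) =
      (∫⁻ t, ENNReal.ofReal (Real.exp (-(σ * t))) ∂ν) ^ k := by
  induction k with
  | zero => simp [convPow, lintegral_dirac]
  | succ k ih =>
    rw [convPow, Measure.lintegral_conv (by fun_prop), pow_succ, ← ih,
      ← lintegral_mul_const _ (by fun_prop)]
    refine lintegral_congr fun x => ?_
    rw [← lintegral_const_mul _ (by fun_prop)]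
    refine lintegral_congr fun y => ?_
    rw [← ENNReal.ofReal_mul (Real.exp_pos _).le, ← Real.exp_add]
    congr 2; ring

theorem integrable_cexp_iff (ν : Measure ℝ) (q : ℂ) :
    Integrable (fun t : ℝ => Complex.exp (-(q * t))) ν ↔
      ∫⁻ t, ENNReal.ofReal (Real.exp (-(q.re * t))) ∂ν < ⊤ := by
  have h : ∫⁻ t : ℝ, ‖Complex.exp (-(q * t))‖ₑ ∂ν =
      ∫⁻ t, ENNReal.ofReal (Real.exp (-(q.re * t))) ∂ν := by
    refine lintegral_congr fun t => ?_
    rw [← ofReal_norm, Complex.norm_exp]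
    simp
  rw [← h]
  exact ⟨fun h => h.2, fun h => ⟨Continuous.aestronglyMeasurable (by fun_prop), h⟩⟩

theorem integral_cexp_convPow (ν : Measure ℝ) [IsFiniteMeasure ν] {q : ℂ}
    (h : Integrable (fun t : ℝ => Complex.exp (-(q * t))) ν) (k : ℕ) :
    ∫ t : ℝ, Complex.exp (-(q * t)) ∂(convPow ν k) =
      (∫ t : ℝ, Complex.exp (-(q * t)) ∂ν) ^ k := by
  have hk (k : ℕ) : Integrable (fun t : ℝ => Complex.exp (-(q * t))) (convPow ν k) := by
    rw [integrable_cexp_iff, lintegral_exp_convPow]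
    exact ENNReal.pow_lt_top ((integrable_cexp_iff ν q).1 h)
  induction k with
  | zero => simp [convPow, integral_dirac]
  | succ k ih =>
    have := hk (k + 1)
    rw [convPow] at this ⊢
    rw [integral_conv this, pow_succ, ← ih, ← integral_mul_const]
    refine integral_congr_ae (Eventually.of_forall fun x => ?_)
    simp only
    rw [← integral_const_mul]
    refine integral_congr_ae (Eventually.of_forall fun y => ?_)
    simp only
    rw [← Complex.exp_add]
    congr 1; push_cast; ring

theorem ae_nonneg_convPow (ν : Measure ℝ) [IsFiniteMeasure ν] (h : ∀ᵐ t ∂ν, 0 ≤ t) (k : ℕ) :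
    ∀ᵐ t ∂(convPow ν k), 0 ≤ t := by
  induction k with
  | zero => rw [convPow, ae_dirac_iff measurableSet_Ici]
  | succ k ih =>
    rw [convPow, Measure.conv, ae_map_iff (by fun_prop) measurableSet_Ici]
    filter_upwards [Measure.quasiMeasurePreserving_fst.ae ih,
      Measure.quasiMeasurePreserving_snd.ae h] with x h1 h2 using add_nonneg h1 h2

/-- The compound Poisson law with Lévy measure `ν`. -/
def compoundPoisson (ν : Measure ℝ) : Measure ℝ :=
  Measure.sum fun k : ℕ =>
    ENNReal.ofReal (Real.exp (-ν.real univ) / k.factorial) • convPow ν k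

/-- The Poisson weights sum the powers `L ^ k` to an exponential. Taking `σ = 0` gives total mass
`1`, and finiteness gives integrability of complex exponentials. -/
theorem lintegral_exp_compoundPoisson (ν : Measure ℝ) [IsFiniteMeasure ν] {σ L : ℝ} (hL : 0 ≤ L)
    (h : ∫⁻ t, ENNReal.ofReal (Real.exp (-(σ * t))) ∂ν = ENNReal.ofReal L) :
    ∫⁻ t, ENNReal.ofReal (Real.exp (-(σ * t))) ∂(compoundPoisson ν) =
      ENNReal.ofReal (Real.exp (L - ν.real univ)) := by
  have hs : HasSum (fun k : ℕ => Real.exp (-ν.real univ) * (L ^ k / k.factorial))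
      (Real.exp (-ν.real univ) * Real.exp L) := by
    rw [Real.exp_eq_exp_ℝ]
    exact (NormedSpace.expSeries_div_hasSum_exp L).mul_left _
  rw [compoundPoisson, lintegral_sum_measure, sub_eq_neg_add, Real.exp_add, ← hs.tsum_eq,
    ENNReal.ofReal_tsum_of_nonneg (fun k => by positivity) hs.summable]
  refine tsum_congr fun k => ?_
  rw [lintegral_smul_measure, lintegral_exp_convPow, h, ← ENNReal.ofReal_pow hL, smul_eq_mul,
    ← ENNReal.ofReal_mul (by positivity)]
  congr 1; ring

instance (ν : Measure ℝ) [IsFiniteMeasure ν] : IsProbabilityMeasure (compoundPoisson ν) := by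
  constructor
  have := lintegral_exp_compoundPoisson ν (σ := 0) (L := ν.real univ) (by positivity) (by simp)
  simpa using this

theorem ae_nonneg_compoundPoisson (ν : Measure ℝ) [IsFiniteMeasure ν] (h : ∀ᵐ t ∂ν, 0 ≤ t) :
    ∀ᵐ t ∂(compoundPoisson ν), 0 ≤ t := by
  rw [compoundPoisson, Measure.ae_sum_iff]
  exact fun k => Measure.ae_smul_measure (ae_nonneg_convPow ν h k) _

theorem integrable_cexp_compoundPoisson (ν : Measure ℝ) [IsFiniteMeasure ν] {q : ℂ}
    (h : Integrable (fun t : ℝ => Complex.exp (-(q * t))) ν) :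
    Integrable (fun t : ℝ => Complex.exp (-(q * t))) (compoundPoisson ν) := by
  rw [integrable_cexp_iff] at h ⊢
  rw [lintegral_exp_compoundPoisson ν ENNReal.toReal_nonneg (ENNReal.ofReal_toReal h.ne).symm]
  exact ENNReal.ofReal_lt_top

theorem integral_cexp_compoundPoisson (ν : Measure ℝ) [IsFiniteMeasure ν] {q : ℂ}
    (h : Integrable (fun t : ℝ => Complex.exp (-(q * t))) ν) :
    ∫ t : ℝ, Complex.exp (-(q * t)) ∂(compoundPoisson ν) =
      Complex.exp (∫ t : ℝ, Complex.exp (-(q * t)) ∂ν - ν.real univ) := by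
  have h1 := hasSum_integral_measure (integrable_cexp_compoundPoisson ν h)
  refine h1.unique ?_
  set φ := ∫ t : ℝ, Complex.exp (-(q * t)) ∂ν
  have hs : HasSum (fun k : ℕ => Complex.exp (-ν.real univ) * (φ ^ k / k.factorial))
      (Complex.exp (-ν.real univ) * Complex.exp φ) := by
    rw [Complex.exp_eq_exp_ℂ]
    exact (NormedSpace.expSeries_div_hasSum_exp φ).mul_left _
  rw [sub_eq_neg_add, Complex.exp_add]
  refine hs.congr_fun fun k => ?_
  rw [integral_smul_measure, integral_cexp_convPow ν h, ENNReal.toReal_ofReal (by positivity),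
    Complex.real_smul]
  push_cast
  ring

/-- `e^{-b_0 t} ∏_j (1 - e^{-b_j t})` -/
def levyKernel {N : ℕ} (b : Fin (N + 1) → ℝ) (t : ℝ) : ℝ :=
  Real.exp (-(b 0 * t)) * ∏ j : Fin N, (1 - Real.exp (-(b j.succ * t)))

theorem continuous_levyKernel {N : ℕ} (b : Fin (N + 1) → ℝ) : Continuous (levyKernel b) := by
  unfold levyKernel; fun_prop

theorem levyKernel_eq_sum {N : ℕ} (b : Fin (N + 1) → ℝ) (t : ℝ) :
    levyKernel b t = ∑ s : Finset (Fin N), (-1) ^ s.card * Real.exp (-(shift b s * t)) := by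
  simp only [levyKernel, sub_eq_add_neg]
  rw [Finset.prod_one_add, Finset.mul_sum, Finset.powerset_univ]
  refine Finset.sum_congr rfl fun s _ => ?_
  rw [Finset.prod_neg, ← Real.exp_sum, mul_left_comm, ← Real.exp_add]
  congr 2
  rw [shift, Finset.sum_neg_distrib, add_mul, Finset.sum_mul]
  ring

theorem levyKernel_nonneg {N : ℕ} {b : Fin (N + 1) → ℝ} (hb : ∀ j, 0 < b j) {t : ℝ} (ht : 0 < t) :
    0 ≤ levyKernel b t :=
  mul_nonneg (Real.exp_pos _).le (Finset.prod_nonneg fun j _ => by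
    rw [sub_nonneg, Real.exp_le_one_iff]
    have := mul_pos (hb j.succ) ht
    linarith)

/-- The factor `1 - e^{-b_1 t} ≤ b_1 t` absorbs the singularity `t⁻¹`, making the Lévy measure
finite. At least one such factor is needed, hence `Fin (N + 2)`. -/
theorem inv_mul_levyKernel_le {N : ℕ} {b : Fin (N + 2) → ℝ} (hb : ∀ j, 0 < b j) {t : ℝ}
    (ht : 0 < t) : t⁻¹ * levyKernel b t ≤ b 1 * Real.exp (-(b 0 * t)) := by
  have h1 (j : Fin (N + 1)) : 0 ≤ 1 - Real.exp (-(b j.succ * t)) := by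
    rw [sub_nonneg, Real.exp_le_one_iff]
    have := mul_pos (hb j.succ) ht
    linarith
  have h2 : ∏ j : Fin N, (1 - Real.exp (-(b j.succ.succ * t))) ≤ 1 :=
    Finset.prod_le_one (fun j _ => h1 j.succ) fun j _ => by
      have := Real.exp_pos (-(b j.succ.succ * t)); linarith
  have h3 : 1 - Real.exp (-(b 1 * t)) ≤ b 1 * t := by
    have := Real.add_one_le_exp (-(b 1 * t)); linarith
  have h4 := h1 0
  rw [levyKernel, Fin.prod_univ_succ]
  rw [Fin.succ_zero_eq_one] at h4 ⊢
  calc _ ≤ t⁻¹ * (Real.exp (-(b 0 * t)) * ((b 1 * t) * 1)) := by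
        have := mul_pos (hb 1) ht
        gcongr
        exact Finset.prod_nonneg fun j _ => h1 j.succ
    _ = _ := by field_simp

/-- Both exponentials are compared with `e^{-t}`, by `integral_expRem` at order `0` and `Ω = 0`. -/
theorem integral_inv_mul_cexp_sub {u v : ℂ} (hu : 0 < u.re) (hv : 0 < v.re) :
    IntegrableOn (fun t : ℝ => (t : ℂ)⁻¹ * (Complex.exp (-(u * t)) - Complex.exp (-(v * t))))
      (Ioi 0) ∧
    ∫ t in Ioi (0 : ℝ), (t : ℂ)⁻¹ * (Complex.exp (-(u * t)) - Complex.exp (-(v * t))) =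
      Complex.log v - Complex.log u := by
  have e (t : ℝ) : (t : ℂ)⁻¹ * (Complex.exp (-(u * t)) - Complex.exp (-(v * t))) =
      (t : ℂ)⁻¹ * (expRem 0 u t * (Real.exp (-(0 * t)) : ℝ)) -
      (t : ℂ)⁻¹ * (expRem 0 v t * (Real.exp (-(0 * t)) : ℝ)) := by
    simp [expRem]
    ring
  have h1 := integrableOn_inv_mul_expRem 0 hu le_rfl
  have h2 := integrableOn_inv_mul_expRem 0 hv le_rfl
  simp only [e]
  refine ⟨h1.sub h2, ?_⟩
  rw [integral_sub h1 h2, integral_expRem 0 hu le_rfl, integral_expRem 0 hv le_rfl,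
    Complex.logTaylor_succ, Complex.logTaylor_zero]
  simp
  ring

/-- Expanding the product in the Lévy density gives an alternating sum over subsets, and each
summand is a Frullani integral. -/
theorem integral_inv_mul_cexp_sub_levyKernel {N : ℕ} {b : Fin (N + 1) → ℝ} (hb : ∀ j, 0 < b j)
    {q : ℂ} (hq : -b 0 < q.re) :
    Complex.exp (∫ t in Ioi (0 : ℝ),
      (t : ℂ)⁻¹ * ((Complex.exp (-(q * t)) - 1) * (levyKernel b t : ℂ))) = barnesFactor b q 0 := by
  have hre (s : Finset (Fin N)) : 0 < (q + shift b s).re := by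
    have : b 0 ≤ shift b s := le_add_of_nonneg_right (Finset.sum_nonneg fun j _ => (hb _).le)
    simp only [Complex.add_re, Complex.ofReal_re]
    linarith
  have h (s : Finset (Fin N)) := integral_inv_mul_cexp_sub (hre s) (v := shift b s)
    (by simpa using shift_pos hb s)
  have e (t : ℝ) : (t : ℂ)⁻¹ * ((Complex.exp (-(q * t)) - 1) * (levyKernel b t : ℂ)) =
      ∑ s : Finset (Fin N), (-1 : ℂ) ^ s.card *
        ((t : ℂ)⁻¹ * (Complex.exp (-((q + shift b s) * t)) - Complex.exp (-(shift b s * t)))) := by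
    rw [levyKernel_eq_sum]
    push_cast
    rw [Finset.mul_sum, Finset.mul_sum]
    refine Finset.sum_congr rfl fun s _ => ?_
    rw [show -((q + shift b s) * (t : ℂ)) = -(q * t) + -(shift b s * t) by ring, Complex.exp_add]
    ring
  simp only [e]
  rw [integral_finsetSum _ fun s _ => (h s).1.const_mul _, Complex.exp_sum, barnesFactor]
  refine Finset.prod_congr rfl fun s _ => ?_
  have hx : q + shift b s ≠ 0 := fun h => by have := hre s; rw [h] at this; simp at this
  have hy : (shift b s : ℂ) ≠ 0 := by exact_mod_cast (shift_pos hb s).ne'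
  rw [integral_const_mul, (h s).2, Complex.exp_neg_one_pow_mul_log_sub hx hy]
  simp

theorem notMem_cut_of_re {N : ℕ} {b : Fin (N + 1) → ℝ} {q : ℂ} (hq : -b 0 < q.re) :
    q ∉ ((↑) : ℝ → ℂ) '' Iic (-b 0) := by
  rintro ⟨x, hx, rfl⟩
  simp only [Complex.ofReal_re, mem_Iic] at hq hx
  linarith

/-- Integrability and integrals with respect to a density on the positive half line. -/
theorem withDensity_ofReal_Ioi {ρ : ℝ → ℝ} (hρ : Measurable ρ) (h0 : ∀ t, 0 < t → 0 ≤ ρ t)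
    (f : ℝ → ℂ) :
    (Integrable f ((volume.restrict (Ioi 0)).withDensity fun t => ENNReal.ofReal (ρ t)) ↔
      IntegrableOn (fun t => (ρ t : ℂ) * f t) (Ioi 0)) ∧
    ∫ t, f t ∂((volume.restrict (Ioi 0)).withDensity fun t => ENNReal.ofReal (ρ t)) =
      ∫ t in Ioi 0, (ρ t : ℂ) * f t := by
  have e : (fun t => (ENNReal.ofReal (ρ t)).toReal • f t) =ᵐ[volume.restrict (Ioi 0)]
      fun t => (ρ t : ℂ) * f t := by
    filter_upwards [ae_restrict_mem measurableSet_Ioi] with t ht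
    rw [ENNReal.toReal_ofReal (h0 t ht), Complex.real_smul]
  constructor
  · rw [integrable_withDensity_iff_integrable_smul' (by fun_prop) (by simp), integrable_congr e]
    rfl
  · rw [integral_withDensity_eq_integral_toReal_smul (by fun_prop) (by simp)]
    exact integral_congr_ae e

theorem integrableOn_exp_mul_cexp {c : ℝ} {q : ℂ} (hq : -c < q.re) :
    IntegrableOn (fun t : ℝ => (Real.exp (-(c * t)) : ℂ) * Complex.exp (-(q * t))) (Ioi 0) := by
  have := integrableOn_exp_mul_complex_Ioi (a := -(q + c)) (by simp; linarith) 0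
  refine this.congr_fun (fun t _ => ?_) measurableSet_Ioi
  simp only
  push_cast
  rw [← Complex.exp_add]
  congr 1; ring

theorem exists_isBarnesBetaLaw_zero {N : ℕ} {b : Fin (N + 1) → ℝ} (hb : ∀ j, 0 < b j) :
    ∃ μ, IsBarnesBetaLaw (Fin.elim0 : Fin 0 → ℝ) b μ := by
  -- For `N = 0` the measure `t⁻¹ e^{-b_0 t} dt` is infinite, so the exponential law of rate `b_0`
  -- is used directly. For `N ≥ 1` the Lévy measure is finite.
  rcases N with _ | N
  · set ρ : ℝ → ℝ := fun t => b 0 * Real.exp (-(b 0 * t)) with hρ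
    have hρm : Measurable ρ := by fun_prop
    have hρ0 : ∀ t, 0 < t → 0 ≤ ρ t := fun t _ => mul_nonneg (hb 0).le (Real.exp_pos _).le
    set m := (volume.restrict (Ioi (0 : ℝ))).withDensity fun t => ENNReal.ofReal (ρ t) with hm
    have hint {q : ℂ} (hq : -b 0 < q.re) :
        IntegrableOn (fun t : ℝ => (ρ t : ℂ) * Complex.exp (-(q * t))) (Ioi 0) := by
      refine Integrable.congr ((integrableOn_exp_mul_cexp hq).const_mul (b 0 : ℂ))
        (Eventually.of_forall fun t => ?_)
      simp only [hρ]
      push_cast; ring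
    have hρi : IntegrableOn ρ (Ioi 0) := by
      have := (integrableOn_pow_mul_exp_neg_mul (hb 0) 0).const_mul (b 0)
      simp only [pow_zero, one_mul] at this
      exact this
    have : IsProbabilityMeasure m := by
      constructor
      rw [hm, withDensity_apply _ MeasurableSet.univ, Measure.restrict_univ,
        ← ofReal_integral_eq_lintegral_ofReal hρi]
      · have := integral_pow_mul_exp_neg_mul (hb 0) 0
        simp only [pow_zero, one_mul] at this
        simp only [hρ]
        rw [integral_const_mul, this]
        simp [(hb 0).ne']
      · filter_upwards [ae_restrict_mem measurableSet_Ioi] with t ht using hρ0 t ht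
    refine ⟨_, isBarnesBetaLaw_map_exp_neg (m := m) ?_ (fun q hq => ?_) fun q hq => ?_⟩
    · refine (withDensity_absolutelyContinuous _ _).ae_le ?_
      filter_upwards [ae_restrict_mem measurableSet_Ioi] with t ht using (mem_Ioi.1 ht).le
    · exact (withDensity_ofReal_Ioi hρm hρ0 _).1.2 (hint hq)
    · rw [eta_elim0 hb (notMem_cut_of_re hq), hm, (withDensity_ofReal_Ioi hρm hρ0 _).2]
      have h1 := integral_exp_mul_complex_Ioi (a := -(q + b 0)) (by simp; linarith) 0
      have h2 : q + b 0 ≠ 0 := fun h => by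
        have := congrArg Complex.re h
        simp at this
        linarith
      have h3 : (fun t : ℝ => (ρ t : ℂ) * Complex.exp (-(q * t))) =
          fun t : ℝ => (b 0 : ℂ) * Complex.exp (-(q + b 0) * t) := by
        ext t
        simp only [hρ]
        push_cast
        rw [mul_assoc, ← Complex.exp_add]
        congr 2; ring
      rw [h3, integral_const_mul, h1, barnesFactor, Fintype.prod_subsingleton _ ∅]
      simp only [Complex.ofReal_zero, mul_zero, Complex.exp_zero, shift, Finset.sum_empty,
        add_zero, Finset.card_empty, zero_add, pow_one, zpow_neg_one, inv_div, neg_div_neg_eq]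
      ring
  · set ρ : ℝ → ℝ := fun t => t⁻¹ * levyKernel b t with hρ
    have hρm : Measurable ρ := measurable_inv.mul (continuous_levyKernel b).measurable
    have hρ0 : ∀ t, 0 < t → 0 ≤ ρ t := fun t ht =>
      mul_nonneg (inv_nonneg.2 ht.le) (levyKernel_nonneg hb ht)
    set ν := (volume.restrict (Ioi (0 : ℝ))).withDensity fun t => ENNReal.ofReal (ρ t) with hν
    have hint {q : ℂ} (hq : -b 0 < q.re) :
        IntegrableOn (fun t : ℝ => (ρ t : ℂ) * Complex.exp (-(q * t))) (Ioi 0) := by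
      refine Integrable.mono' ((integrableOn_exp_mul_cexp hq).norm.const_mul (b 1)) ?_ ?_
      · exact ((Complex.measurable_ofReal.comp hρm).mul
          (Continuous.measurable (by fun_prop))).aestronglyMeasurable
      · filter_upwards [ae_restrict_mem measurableSet_Ioi] with t ht
        rw [norm_mul, norm_mul, ← mul_assoc, Complex.norm_real, Complex.norm_real,
          Real.norm_of_nonneg (hρ0 t ht), Real.norm_of_nonneg (Real.exp_pos _).le]
        exact mul_le_mul_of_nonneg_right (inv_mul_levyKernel_le hb ht) (norm_nonneg _)
    have hνi {q : ℂ} (hq : -b 0 < q.re) : Integrable (fun t : ℝ => Complex.exp (-(q * t))) ν :=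
      (withDensity_ofReal_Ioi hρm hρ0 _).1.2 (hint hq)
    have h00 : -b 0 < (0 : ℂ).re := by simpa using hb 0
    have : IsFiniteMeasure ν := by
      constructor
      have := (integrable_cexp_iff ν 0).1 (hνi h00)
      simpa using this
    refine ⟨_, isBarnesBetaLaw_map_exp_neg (m := compoundPoisson ν)
      (ae_nonneg_compoundPoisson ν ?_)
      (fun q hq => integrable_cexp_compoundPoisson ν (hνi hq)) fun q hq => ?_⟩
    · refine (withDensity_absolutelyContinuous _ _).ae_le ?_
      filter_upwards [ae_restrict_mem measurableSet_Ioi] with t ht using (mem_Ioi.1 ht).le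
    · rw [integral_cexp_compoundPoisson ν (hνi hq), eta_elim0 hb (notMem_cut_of_re hq),
        ← integral_inv_mul_cexp_sub_levyKernel hb hq]
      congr 1
      have h1 : ((ν.real univ : ℝ) : ℂ) = ∫ t : ℝ, Complex.exp (-(0 * t)) ∂ν := by simp
      rw [h1, (withDensity_ofReal_Ioi hρm hρ0 _).2, (withDensity_ofReal_Ioi hρm hρ0 _).2,
        ← integral_sub (hint hq) (hint h00)]
      refine integral_congr_ae (Eventually.of_forall fun t => ?_)
      simp only [hρ, zero_mul, neg_zero, Complex.exp_zero]
      push_cast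
      ring

/-! ### Uniqueness of the law and the infinite product of independent variables. -/

theorem IsBarnesBetaLaw.ae_mem {M N : ℕ} {a : Fin M → ℝ} {b : Fin (N + 1) → ℝ} {μ : Measure ℝ}
    (h : IsBarnesBetaLaw a b μ) : ∀ᵐ x ∂μ, x ∈ Ioc (0 : ℝ) 1 :=
  ae_iff.2 h.support

/-- On the imaginary axis, which lies in the domain because `b_0 > 0`, the Mellin transform is the
characteristic function of the logarithm. -/
theorem IsBarnesBetaLaw.unique {M N : ℕ} {a : Fin M → ℝ} {b : Fin (N + 1) → ℝ} (hb : 0 < b 0)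
    {μ ν : Measure ℝ} (hμ : IsBarnesBetaLaw a b μ) (hν : IsBarnesBetaLaw a b ν) : μ = ν := by
  have hchar {κ : Measure ℝ} (h : IsBarnesBetaLaw a b κ) (ξ : ℝ) :
      charFun (κ.map Real.log) ξ = eta a b (ξ * Complex.I) := by
    rw [charFun_apply_real, integral_map Real.measurable_log.aemeasurable
      (Continuous.aestronglyMeasurable (by fun_prop)), ← h.mellin _ (by simpa using hb)]
    refine integral_congr_ae ?_
    filter_upwards [h.ae_mem] with x hx
    rw [Complex.cpow_def_of_ne_zero (by exact_mod_cast hx.1.ne'), ← Complex.ofReal_log hx.1.le]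
    congr 1; ring
  have hback {κ : Measure ℝ} (h : IsBarnesBetaLaw a b κ) :
      (κ.map Real.log).map Real.exp = κ := by
    rw [Measure.map_map Real.measurable_exp Real.measurable_log]
    have : Real.exp ∘ Real.log =ᵐ[κ] id := by
      filter_upwards [h.ae_mem] with x hx using Real.exp_log hx.1
    rw [Measure.map_congr this, Measure.map_id]
  have := hμ.isProbabilityMeasure
  have := hν.isProbabilityMeasure
  have h : μ.map Real.log = ν.map Real.log :=
    Measure.ext_of_charFun (funext fun ξ => by rw [hchar hμ, hchar hν])
  rw [← hback hμ, ← hback hν, h]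

theorem isBarnesBetaLaw_barnesBetaLaw {M N : ℕ} {a : Fin M → ℝ} {b : Fin (N + 1) → ℝ}
    (h : ∃ μ, IsBarnesBetaLaw a b μ) : IsBarnesBetaLaw a b (barnesBetaLaw a b) := by
  have e : barnesBetaLaw a b = h.choose := by simp only [barnesBetaLaw, dif_pos h]
  rw [e]
  exact h.choose_spec

theorem antitone_finsetProd {ι : Type*} {x : ι → ℝ} (h : ∀ i, x i ∈ Ioc (0 : ℝ) 1) :
    Antitone fun F : Finset ι => ∏ i ∈ F, x i := fun F F' hF => by
  classical
  refine Finset.prod_le_prod_of_subset_of_le_one hF (fun i _ => (h i).1.le) fun i _ _ => (h i).2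

theorem hasProd_ciInf {ι : Type*} {x : ι → ℝ} (h : ∀ i, x i ∈ Ioc (0 : ℝ) 1) :
    HasProd x (⨅ F : Finset ι, ∏ i ∈ F, x i) := by
  rw [HasProd, SummationFilter.unconditional_filter]
  refine tendsto_atTop_ciInf (antitone_finsetProd h) ⟨0, ?_⟩
  rintro _ ⟨F, rfl⟩
  exact Finset.prod_nonneg fun i _ => (h i).1.le

theorem update_pos {N : ℕ} {b : Fin (N + 1) → ℝ} (hb : ∀ j, 0 < b j) {Ω : ℝ} (hΩ : 0 ≤ Ω) :
    ∀ j, 0 < Function.update b 0 (b 0 + Ω) j := by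
  intro j
  rcases eq_or_ne j 0 with rfl | hj
  · simpa using add_pos_of_pos_of_nonneg (hb 0) hΩ
  · simpa [Function.update_of_ne hj] using hb j

theorem norm_ofReal_cpow {x : ℝ} (hx : 0 < x) (q : ℂ) : ‖(x : ℂ) ^ q‖ = x ^ q.re :=
  Complex.norm_cpow_eq_rpow_re_of_pos hx q

/-- The product of independent `β_{0,N}(b_0 + Ω(n))` variables has the law `β_{M,N}`. -/
theorem isBarnesBetaLaw_map_tprod {M N : ℕ} (hMN : M ≤ N) {a : Fin M → ℝ} (ha : ∀ i, 0 < a i)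
    {b : Fin (N + 1) → ℝ} (hb : ∀ j, 0 < b j) {S : Type*} [MeasurableSpace S] {P : Measure S}
    [IsProbabilityMeasure P] {X : (Fin M → ℕ) → S → ℝ} {μ : (Fin M → ℕ) → Measure ℝ}
    (hμ : ∀ n, IsBarnesBetaLaw (Fin.elim0 : Fin 0 → ℝ)
      (Function.update b 0 (b 0 + latticeSum a n)) (μ n))
    (hX : ∀ n, HasLaw (X n) (μ n) P) (hind : iIndepFun X P) :
    (∀ᵐ ω ∂P, Multipliable fun n => X n ω) ∧ AEMeasurable (fun ω => ∏' n, X n ω) P ∧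
      IsBarnesBetaLaw a b (P.map fun ω => ∏' n, X n ω) := by
  have hXm (n) : AEMeasurable (X n) P := (hX n).aemeasurable
  have hmem : ∀ᵐ ω ∂P, ∀ n, X n ω ∈ Ioc (0 : ℝ) 1 := by
    rw [ae_all_iff]
    intro n
    have := (hμ n).ae_mem
    rw [← (hX n).map_eq] at this
    exact ae_of_ae_map (hXm n) this
  set Y : S → ℝ := fun ω => ∏' n, X n ω with hY
  have hprod {ω : S} (h : ∀ n, X n ω ∈ Ioc (0 : ℝ) 1) : HasProd (fun n => X n ω) (Y ω) :=
    (hasProd_ciInf h).multipliable.hasProd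
  -- Fatou's lemma and dominated convergence need a sequence, so the net of finite sets is replaced
  -- by a sequence tending to it.
  obtain ⟨F, hF⟩ := (atTop : Filter (Finset (Fin M → ℕ))).exists_seq_tendsto
  set Z : ℕ → S → ℝ := fun k ω => ∏ n ∈ F k, X n ω with hZ
  have hZm (k) : AEMeasurable (Z k) P := Finset.aemeasurable_fun_prod _ fun n _ => hXm n
  have hZpos {ω : S} (h : ∀ n, X n ω ∈ Ioc (0 : ℝ) 1) (k : ℕ) : 0 < Z k ω :=
    Finset.prod_pos fun n _ => (h n).1
  have hZ1 {ω : S} (h : ∀ n, X n ω ∈ Ioc (0 : ℝ) 1) (k : ℕ) : Z k ω ≤ 1 :=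
    Finset.prod_le_one (fun n _ => (h n).1.le) fun n _ => (h n).2
  have hZY {ω : S} (h : ∀ n, X n ω ∈ Ioc (0 : ℝ) 1) :
      Tendsto (fun k => Z k ω) atTop (𝓝 (Y ω)) := by
    have := hprod h
    rw [HasProd, SummationFilter.unconditional_filter] at this
    exact this.comp hF
  have hYZ {ω : S} (h : ∀ n, X n ω ∈ Ioc (0 : ℝ) 1) (k : ℕ) : Y ω ≤ Z k ω := by
    have := hprod h
    rw [HasProd, SummationFilter.unconditional_filter] at this
    exact (antitone_finsetProd h).le_of_tendsto this (F k)
  have hYm : AEMeasurable Y P := by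
    refine aemeasurable_of_tendsto_metrizable_ae atTop hZm ?_
    filter_upwards [hmem] with ω h using hZY h
  have hcm (q : ℂ) : Measurable fun x : ℝ => (x : ℂ) ^ q := by fun_prop
  have hcut {q : ℂ} (hq : -b 0 < q.re) (n : Fin M → ℕ) :
      -Function.update b 0 (b 0 + latticeSum a n) 0 < q.re := by
    have := latticeSum_nonneg ha n
    rw [Function.update_self]
    linarith
  have hXint {q : ℂ} (hq : -b 0 < q.re) (n : Fin M → ℕ) :
      ∫ ω, ((X n ω : ℝ) : ℂ) ^ q ∂P = barnesFactor b q (latticeSum a n) := by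
    rw [← eta_update hb (latticeSum_nonneg ha n) (notMem_cut_of_re hq),
      ← (hμ n).mellin q (hcut hq n), ← (hX n).map_eq,
      integral_map (hXm n) (hcm q).aestronglyMeasurable]
  have hZcpow {ω : S} (h : ∀ n, X n ω ∈ Ioc (0 : ℝ) 1) (k : ℕ) (q : ℂ) :
      ((Z k ω : ℝ) : ℂ) ^ q = ∏ n ∈ F k, ((X n ω : ℝ) : ℂ) ^ q := by
    have : ∀ T : Finset (Fin M → ℕ), ((∏ n ∈ T, X n ω : ℝ) : ℂ) ^ q =
        ∏ n ∈ T, ((X n ω : ℝ) : ℂ) ^ q := by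
      classical
      intro T
      induction T using Finset.induction_on with
      | empty => simp
      | insert n T hn ih =>
        rw [Finset.prod_insert hn, Finset.prod_insert hn, Complex.ofReal_mul,
          Complex.mul_cpow_ofReal_nonneg (h n).1.le (Finset.prod_nonneg fun n _ => (h n).1.le), ih]
    exact this (F k)
  have hZint {q : ℂ} (hq : -b 0 < q.re) (k : ℕ) :
      ∫ ω, ((Z k ω : ℝ) : ℂ) ^ q ∂P = ∏ n ∈ F k, barnesFactor b q (latticeSum a n) := by
    have h1 : iIndepFun (fun (n : F k) ω => ((X n ω : ℝ) : ℂ) ^ q) P :=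
      (hind.precomp Subtype.val_injective).comp (fun _ x => (x : ℂ) ^ q) fun _ => hcm q
    have h2 := h1.integral_fun_prod_eq_prod_integral fun n =>
      ((hcm q).comp_aemeasurable (hXm n)).aestronglyMeasurable
    rw [← Finset.prod_coe_sort, ← Finset.prod_congr rfl fun n _ => hXint hq n.1, ← h2]
    refine integral_congr_ae ?_
    filter_upwards [hmem] with ω h
    rw [hZcpow h k q, ← Finset.prod_coe_sort]
  have hlim {q : ℂ} (hq : -b 0 < q.re) :
      Tendsto (fun k => ∫ ω, ((Z k ω : ℝ) : ℂ) ^ q ∂P) atTop (𝓝 (eta a b q)) := by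
    have := hasProd_barnesFactor hMN ha hb (notMem_cut_of_re hq)
    rw [HasProd, SummationFilter.unconditional_filter] at this
    simp only [hZint hq]
    exact this.comp hF
  have hZi {q : ℂ} (hq : -b 0 < q.re) (k : ℕ) :
      Integrable (fun ω => ((Z k ω : ℝ) : ℂ) ^ q) P := by
    -- The integral is a finite product of exponentials, hence nonzero, which forces integrability.
    refine Integrable.of_integral_ne_zero ?_
    rw [hZint hq, Finset.prod_ne_zero_iff]
    intro n _
    rw [← exp_opS_regTerm hMN hb (notMem_cut_of_re hq) (latticeSum_nonneg ha n)]
    exact Complex.exp_ne_zero _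
  have hfin {σ : ℝ} (hσ : -b 0 < σ) :
      ∫⁻ ω, ENNReal.ofReal (Y ω) ^ σ ∂P < ⊤ := by
    have hq : -b 0 < (σ : ℂ).re := by simpa using hσ
    have h1 (k : ℕ) : ∫⁻ ω, ENNReal.ofReal (Z k ω) ^ σ ∂P =
        ENNReal.ofReal (∫ ω, ((Z k ω : ℝ) : ℂ) ^ (σ : ℂ) ∂P).re := by
      have h3 : (∫ ω, ((Z k ω : ℝ) : ℂ) ^ (σ : ℂ) ∂P).re = ∫ ω, Z k ω ^ σ ∂P := by
        rw [← Complex.reCLM_apply, ← Complex.reCLM.integral_comp_comm (hZi hq k)]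
        refine integral_congr_ae ?_
        filter_upwards [hmem] with ω h
        rw [Complex.reCLM_apply, ← Complex.ofReal_cpow (hZpos h k).le, Complex.ofReal_re]
      have h4 : Integrable (fun ω => Z k ω ^ σ) P := by
        refine (Complex.reCLM.integrable_comp (hZi hq k)).congr ?_
        filter_upwards [hmem] with ω h
        rw [Complex.reCLM_apply, ← Complex.ofReal_cpow (hZpos h k).le, Complex.ofReal_re]
      rw [h3, ofReal_integral_eq_lintegral_ofReal h4]
      · refine lintegral_congr_ae ?_
        filter_upwards [hmem] with ω h
        rw [ENNReal.ofReal_rpow_of_pos (hZpos h k)]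
      · filter_upwards [hmem] with ω h using (Real.rpow_pos_of_pos (hZpos h k) _).le
    have h2 : Tendsto (fun k => ∫⁻ ω, ENNReal.ofReal (Z k ω) ^ σ ∂P) atTop
        (𝓝 (ENNReal.ofReal (eta a b σ).re)) := by
      simp only [h1]
      exact ENNReal.tendsto_ofReal ((Complex.continuous_re.tendsto _).comp (hlim hq))
    -- Fatou's lemma: the moments of the partial products converge to the finite value `η(σ)`.
    refine lt_of_le_of_lt ?_ (ENNReal.ofReal_lt_top (r := (eta a b σ).re))
    rw [← h2.liminf_eq]
    refine le_trans (le_of_eq ?_) (lintegral_liminf_le'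
      fun k => ((hZm k).ennreal_ofReal.pow_const σ))
    refine lintegral_congr_ae ?_
    filter_upwards [hmem] with ω h
    exact ((ENNReal.continuous_rpow_const.tendsto _).comp
      (ENNReal.tendsto_ofReal (hZY h))).liminf_eq.symm
  have hYpos : ∀ᵐ ω ∂P, 0 < Y ω := by
    -- Any exponent in `(-b_0, 0)` works: where `Y = 0` the negative power is `⊤`, so a finite
    -- moment forces `Y > 0` almost surely.
    have hσ : -b 0 < -(b 0 / 2) := by have := hb 0; linarith
    have h1 := ae_lt_top' (hYm.ennreal_ofReal.pow_const _) (hfin hσ).ne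
    filter_upwards [h1] with ω h
    by_contra hcon
    rw [ENNReal.ofReal_of_nonpos (not_lt.1 hcon), ENNReal.zero_rpow_of_neg
      (by have := hb 0; linarith)] at h
    exact lt_irrefl _ h
  have hY1 : ∀ᵐ ω ∂P, Y ω ≤ 1 := by
    filter_upwards [hmem] with ω h using (hYZ h 0).trans (hZ1 h 0)
  have hYint {σ : ℝ} (hσ : -b 0 < σ) : Integrable (fun ω => Y ω ^ σ) P := by
    refine ⟨(hYm.pow_const σ).aestronglyMeasurable, ?_⟩
    refine lt_of_le_of_lt (le_of_eq (lintegral_congr_ae ?_)) (hfin hσ)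
    filter_upwards [hYpos] with ω h
    rw [← ofReal_norm, Real.norm_of_nonneg (Real.rpow_pos_of_pos h _).le,
      ENNReal.ofReal_rpow_of_pos h]
  refine ⟨?_, hYm, ?_, ?_, fun q hq => ?_, fun q hq => ?_⟩
  · filter_upwards [hmem] with ω h using (hasProd_ciInf h).multipliable
  · exact Measure.isProbabilityMeasure_map hYm
  · rw [Measure.map_apply_of_aemeasurable hYm measurableSet_Ioc.compl]
    have : ∀ᵐ ω ∂P, Y ω ∈ Ioc (0 : ℝ) 1 := by
      filter_upwards [hYpos, hY1] with ω h1 h2 using ⟨h1, h2⟩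
    exact ae_iff.1 this
  · rw [integrable_map_measure (hcm q).aestronglyMeasurable hYm]
    refine (hYint hq).mono' ((hcm q).comp_aemeasurable hYm).aestronglyMeasurable ?_
    filter_upwards [hYpos] with ω h
    exact (norm_ofReal_cpow h q).le
  · rw [integral_map hYm (hcm q).aestronglyMeasurable]
    refine tendsto_nhds_unique ?_ (hlim hq)
    -- Since `Y ≤ Z k ≤ 1`, the power `Z k ^ Re q` is at most `1` if `Re q ≥ 0` and at most `Y ^ Re
    -- q` otherwise.
    refine tendsto_integral_of_dominated_convergence (fun ω => Y ω ^ q.re + 1)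
      (fun k => ((hcm q).comp_aemeasurable (hZm k)).aestronglyMeasurable)
      ((hYint hq).add (integrable_const _)) (fun k => ?_) ?_
    · filter_upwards [hmem, hYpos] with ω h h0
      rw [norm_ofReal_cpow (hZpos h k)]
      rcases le_total 0 q.re with h1 | h1
      · have := Real.rpow_le_one (hZpos h k).le (hZ1 h k) h1
        have := Real.rpow_nonneg h0.le q.re
        linarith
      · have := Real.rpow_le_rpow_of_nonpos h0 (hYZ h k) h1
        linarith
    · filter_upwards [hmem, hYpos] with ω h h0
      have hc : ContinuousAt (fun x : ℝ => (x : ℂ) ^ q) (Y ω) :=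
        Complex.continuousAt_ofReal_cpow_const _ _ (Or.inr h0.ne')
      exact hc.tendsto.comp (hZY h)

end BarnesBeta

end

theorem mainTheorem3 {M N : ℕ} (hMN : M ≤ N)
    (a : Fin M → ℝ) (ha : ∀ i, 0 < a i) (b : Fin (N + 1) → ℝ) (hb : ∀ j, 0 < b j) :
    (∀ q : ℂ, q ∉ ((↑) : ℝ → ℂ) '' Set.Iic (-b 0) →
      HasProd
        (fun n : Fin M → ℕ => BarnesBeta.barnesFactor b q (BarnesBeta.latticeSum a n))
        (BarnesBeta.eta a b q)) ∧
    BarnesBeta.IsBarnesBetaLaw a b (BarnesBeta.barnesBetaLaw a b) ∧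
    (∀ (S : Type*) [MeasurableSpace S] (P : MeasureTheory.Measure S)
      [MeasureTheory.IsProbabilityMeasure P] (X : (Fin M → ℕ) → S → ℝ),
      (∀ n, ProbabilityTheory.HasLaw (X n)
        (BarnesBeta.barnesBetaLaw (Fin.elim0 : Fin 0 → ℝ)
          (Function.update b 0 (b 0 + BarnesBeta.latticeSum a n))) P) →
      ProbabilityTheory.iIndepFun X P →
      (∀ᵐ ω ∂P, Multipliable (fun n => X n ω)) ∧
      ProbabilityTheory.HasLaw (fun ω => ∏' n, X n ω) (BarnesBeta.barnesBetaLaw a b) P) := by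
  have h0 : ∀ n, BarnesBeta.IsBarnesBetaLaw (Fin.elim0 : Fin 0 → ℝ)
      (Function.update b 0 (b 0 + BarnesBeta.latticeSum a n)) (BarnesBeta.barnesBetaLaw _ _) :=
    fun n => BarnesBeta.isBarnesBetaLaw_barnesBetaLaw (BarnesBeta.exists_isBarnesBetaLaw_zero
      (BarnesBeta.update_pos hb (BarnesBeta.latticeSum_nonneg ha n)))
  have hlaw : BarnesBeta.IsBarnesBetaLaw a b (BarnesBeta.barnesBetaLaw a b) := by
    have := fun n => (h0 n).isProbabilityMeasure
    -- Independent factors exist on some probability space, and the law of their product witnesses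
    -- the existence of `β_{M,N}`.
    obtain ⟨S, _, P, X, _, hX, hind, _⟩ := ProbabilityTheory.exists_hasLaw_indepFun
      (fun _ : Fin M → ℕ => ℝ) fun n => BarnesBeta.barnesBetaLaw (Fin.elim0 : Fin 0 → ℝ)
        (Function.update b 0 (b 0 + BarnesBeta.latticeSum a n))
    exact BarnesBeta.isBarnesBetaLaw_barnesBetaLaw
      ⟨_, (BarnesBeta.isBarnesBetaLaw_map_tprod hMN ha hb h0 hX hind).2.2⟩
  refine ⟨fun q hq => BarnesBeta.hasProd_barnesFactor hMN ha hb hq, hlaw,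
    fun S _ P _ X hX hind => ?_⟩
  obtain ⟨h1, h2, h3⟩ := BarnesBeta.isBarnesBetaLaw_map_tprod hMN ha hb h0 hX hind
  exact ⟨h1, h2, h3.unique (hb 0) hlaw⟩
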